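/- **Kähler identities on the standard Podleś sphere.** Let $q$ be a nonzero real number. Let $\mathbf C_q[SU_2]$ be the complex algebra generated by $a,b,c,d$ with the relations $ab=qba$, $ac=qca$, $bc=cb$, $bd=qdb$, $cd=qdc$, $ad-da=(q-q^{-1})bc$, $ad-qbc=1$, the coproduct $\Delta(u_{ij})=\sum_k u_{ik}\otimes u_{kj}$ for the matrix $u=\begin{pmatrix}a&b\\c&d\end{pmatrix}$, and the conjugate-linear anti-multiplicative involution $a^*=d$, $b^*=-qc$, $c^*=-q^{-1}b$, $d^*=a$. It is $\mathbf Z$-graded by $\deg a=\deg c=-1$, $\deg b=\deg d=1$; write $\mathcal E_k$ for the degree-$k$ part (equivalently, $\mathcal E_k=\{f:(\mathrm{id}\otimes\pi)\Delta(f)=f\otimes t^k\}$, where $\pi:\mathbf C_q[SU_2]\to\mathbf C[t,t^{-1}]$ is the algebra map $a\mapsto t^{-1}$, $d\mapsto t$, $b,c\mapsto 0$). The Podleś sphere is $\mathbf C_q[S^2]=\mathcal E_0$. Let $X_\pm$ be the linear maps on $\mathbf C_q[SU_2]$ determined by $X_\pm(fg)=f\,X_\pm(g)+q^{k}X_\pm(f)\,g$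 for $g\in\mathcal E_k$, and $X_+a=b$, $X_+c=d$, $X_+b=X_+d=0$, respectively $X_-b=a$, $X_-d=c$, $X_-a=X_-c=0$. Put $D_+=q^{-1}X_+:\mathcal E_k\to\mathcal E_{k+2}$ and $D_-=-iq\,X_-:\mathcal E_k\to\mathcal E_{k-2}$. The Dolbeault double complex of the Podleś sphere is $$\Omega^\bullet_q(S^2)=\mathbf C_q[S^2]\oplus\mathcal E_2e^+\oplus\mathcal E_{-2}e^-\oplus\mathbf C_q[S^2]\,e^+\wedge e^-,$$ where functions multiply coefficients from either side, $fe^\pm\wedge ge^\pm=0$, $fe^+\wedge ge^-=fg\,e^+\wedge e^-$, $ge^-\wedge fe^+=-q^2gf\,e^+\wedge e^-$, and $$\partial f=D_+(f)e^+,\quad \partial(ge^-)=q^2D_+(g)\,e^+\wedge e^-,\quad \overline\partial f=D_-(f)e^-,\quad \overline\partial(fe^+)=-D_-(f)\,e^+\wedge e^-,$$ $\partial$ and $\overline\partial$ vanishing on the remaining summands. (Thus $e^+$ is the class of $\mathrm d(cd)$, and $e^-$ is $iq^{-1}$ times the class of $\mathrm d(ab)$, normalised so that $(e^+)^*=ie^-$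 and $e^+\wedge e^-$ is $*$-invariant.) There is a unique Haar functional $h$ on $\mathbf C_q[SU_2]$, that is, a linear functional with $h(1)=1$ and $(\mathrm{id}\otimes h)\Delta(f)=h(f)1=(h\otimes\mathrm{id})\Delta(f)$ for all $f$. Give $\Omega^\bullet_q(S^2)$ the form $\langle\omega,\nu\rangle=h(g(\omega,\nu))$, where the metric $g$ is linear in the first and conjugate-linear in the second variable, the four summands are mutually orthogonal, and $$g(f,f')=ff'^*,\quad g(fe^+,f'e^+)=ff'^*,\quad g(fe^-,f'e^-)=q^2ff'^*,\quad g(f\,e^+\wedge e^-,f'\,e^+\wedge e^-)=ff'^*.$$ Let $\kappa=-e^+\wedge e^-$ be the fundamental form and let $L\omega=\omega\wedge\kappa$ be the Lefschetz operator. Then $L$, $\partial$ and $\overline\partial$ have unique adjoints $\Lambda$, $\partial^*$ and $\overline\partial^*$ on $\Omega^\bullet_q(S^2)$ for $\langle\cdot,\cdot\rangle$, and, with $[S,T]=ST-TS$, $$[L,\partial^*]=i\overline\partial,\qquad [L,\overline\partial^*]=-i\partial,\qquad [\Lambda,\partial]=i\overline\partial^*,\qquad [\Lambda,\overline\partial]=-i\partial^*,$$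 $$[L,\partial]=[L,\overline\partial]=[\Lambda,\partial^*]=[\Lambda,\overline\partial^*]=0.$$ -/

import Mathlib

open scoped TensorProduct

namespace PodlesSphere
noncomputable section

/-- The defining relations of `ℂ_q[SL₂]`, for four elements of a complex algebra. -/
structure SL2Rel {B : Type*} [Ring B] [Algebra ℂ B] (q : ℂ) (a b c d : B) : Prop where
  ab : a * b = q • (b * a)
  ac : a * c = q • (c * a)
  bc : b * c = c * b
  bd : b * d = q • (d * b)
  cd : c * d = q • (d * c)
  ad_da : a * d - d * a = (q - q⁻¹) • (b * c)
  det : a * d - q • (b * c) = 1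

/-- The names of the four generators. -/
inductive Gen : Type
  | a | b | c | d

open FreeAlgebra in
/-- The relations of `SL2Rel`, imposed on the generators of the free algebra. -/
inductive Rel (q : ℝˣ) : FreeAlgebra ℂ Gen → FreeAlgebra ℂ Gen → Prop
  | ab : Rel q (ι ℂ Gen.a * ι ℂ Gen.b) ((q : ℂ) • (ι ℂ Gen.b * ι ℂ Gen.a))
  | ac : Rel q (ι ℂ Gen.a * ι ℂ Gen.c) ((q : ℂ) • (ι ℂ Gen.c * ι ℂ Gen.a))
  | bc : Rel q (ι ℂ Gen.b * ι ℂ Gen.c) (ι ℂ Gen.c * ι ℂ Gen.b)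
  | bd : Rel q (ι ℂ Gen.b * ι ℂ Gen.d) ((q : ℂ) • (ι ℂ Gen.d * ι ℂ Gen.b))
  | cd : Rel q (ι ℂ Gen.c * ι ℂ Gen.d) ((q : ℂ) • (ι ℂ Gen.d * ι ℂ Gen.c))
  | ad_da : Rel q (ι ℂ Gen.a * ι ℂ Gen.d - ι ℂ Gen.d * ι ℂ Gen.a)
      (((q : ℂ) - (q : ℂ)⁻¹) • (ι ℂ Gen.b * ι ℂ Gen.c))
  | det : Rel q (ι ℂ Gen.a * ι ℂ Gen.d - (q : ℂ) • (ι ℂ Gen.b * ι ℂ Gen.c)) 1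

/-- The algebra `ℂ_q[SU₂]`: generators `a, b, c, d` and the relations `SL2Rel`. The parameter `q` is
a nonzero real number, which is what the `*`-structure below requires. -/
def SU2 (q : ℝˣ) : Type := RingQuot (Rel q)

instance (q : ℝˣ) : Ring (SU2 q) := inferInstanceAs (Ring (RingQuot (Rel q)))
instance (q : ℝˣ) : Algebra ℂ (SU2 q) := inferInstanceAs (Algebra ℂ (RingQuot (Rel q)))

variable (q : ℝˣ)

/-- The generators. -/
def gen (x : Gen) : SU2 q := RingQuot.mkAlgHom ℂ (Rel q) (FreeAlgebra.ι ℂ x)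

abbrev a : SU2 q := gen q Gen.a
abbrev b : SU2 q := gen q Gen.b
abbrev c : SU2 q := gen q Gen.c
abbrev d : SU2 q := gen q Gen.d

theorem q_ne_zero : (q : ℂ) ≠ 0 := by
  have := q.ne_zero
  exact_mod_cast this

theorem sl2Rel : SL2Rel (q : ℂ) (a q) (b q) (c q) (d q) := by
  have key : ∀ {x y}, Rel q x y → RingQuot.mkAlgHom ℂ (Rel q) x = RingQuot.mkAlgHom ℂ (Rel q) y :=
    fun h => RingQuot.mkAlgHom_rel ℂ h
  constructor
  · have := key Rel.ab; rw [map_smul, map_mul, map_mul] at this; exact this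
  · have := key Rel.ac; rw [map_smul, map_mul, map_mul] at this; exact this
  · have := key Rel.bc; rw [map_mul, map_mul] at this; exact this
  · have := key Rel.bd; rw [map_smul, map_mul, map_mul] at this; exact this
  · have := key Rel.cd; rw [map_smul, map_mul, map_mul] at this; exact this
  · have := key Rel.ad_da
    rw [map_smul, map_sub, map_mul, map_mul, map_mul] at this; exact this
  · have := key Rel.det
    rw [map_sub, map_smul, map_mul, map_mul, map_one] at this; exact this

variable {q} in
/-- The universal property of `ℂ_q[SU₂]`. -/
def lift {B : Type*} [Ring B] [Algebra ℂ B] {a b c d : B} (h : SL2Rel (q : ℂ) a b c d) :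
    SU2 q →ₐ[ℂ] B :=
  RingQuot.liftAlgHom ℂ
    ⟨FreeAlgebra.lift ℂ (fun x => match x with
      | Gen.a => a
      | Gen.b => b
      | Gen.c => c
      | Gen.d => d), by
      intro x y hxy
      cases hxy <;> simp only [map_smul, map_mul, map_sub, map_one, FreeAlgebra.lift_ι_apply]
      exacts [h.ab, h.ac, h.bc, h.bd, h.cd, h.ad_da, h.det]⟩

section
variable {q}
variable {B : Type*} [Ring B] [Algebra ℂ B] {a' b' c' d' : B}
  (h : SL2Rel (q : ℂ) a' b' c' d')

theorem lift_a : lift h (a q) = a' := by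
  simp only [lift, gen]
  exact (RingQuot.liftAlgHom_mkAlgHom_apply ..).trans (FreeAlgebra.lift_ι_apply ..)
theorem lift_b : lift h (b q) = b' := by
  simp only [lift, gen]
  exact (RingQuot.liftAlgHom_mkAlgHom_apply ..).trans (FreeAlgebra.lift_ι_apply ..)
theorem lift_c : lift h (c q) = c' := by
  simp only [lift, gen]
  exact (RingQuot.liftAlgHom_mkAlgHom_apply ..).trans (FreeAlgebra.lift_ι_apply ..)
theorem lift_d : lift h (d q) = d' := by
  simp only [lift, gen]
  exact (RingQuot.liftAlgHom_mkAlgHom_apply ..).trans (FreeAlgebra.lift_ι_apply ..)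

theorem hom_ext {f g : SU2 q →ₐ[ℂ] B} (ha : f (a q) = g (a q)) (hb : f (b q) = g (b q))
    (hc : f (c q) = g (c q)) (hd : f (d q) = g (d q)) : f = g := by
  apply RingQuot.ringQuot_ext'
  apply FreeAlgebra.hom_ext
  funext x
  cases x
  exacts [ha, hb, hc, hd]

end

theorem r_ba : b q * a q = (q : ℂ)⁻¹ • (a q * b q) := by
  rw [(sl2Rel q).ab, smul_smul, inv_mul_cancel₀ (q_ne_zero q), one_smul]
theorem r_ca : c q * a q = (q : ℂ)⁻¹ • (a q * c q) := by
  rw [(sl2Rel q).ac, smul_smul, inv_mul_cancel₀ (q_ne_zero q), one_smul]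
theorem r_cb : c q * b q = b q * c q := (sl2Rel q).bc.symm
theorem r_db : d q * b q = (q : ℂ)⁻¹ • (b q * d q) := by
  rw [(sl2Rel q).bd, smul_smul, inv_mul_cancel₀ (q_ne_zero q), one_smul]
theorem r_dc : d q * c q = (q : ℂ)⁻¹ • (c q * d q) := by
  rw [(sl2Rel q).cd, smul_smul, inv_mul_cancel₀ (q_ne_zero q), one_smul]
theorem r_ad : a q * d q = 1 + (q : ℂ) • (b q * c q) := by
  rw [← (sl2Rel q).det]; abel
theorem r_da : d q * a q = 1 + (q : ℂ)⁻¹ • (b q * c q) := by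
  have h1 := (sl2Rel q).ad_da
  rw [r_ad, sub_smul, sub_eq_iff_eq_add] at h1
  have : d q * a q = 1 + (q : ℂ) • (b q * c q) -
    ((q : ℂ) • (b q * c q) - (q : ℂ)⁻¹ • (b q * c q)) := by rw [h1]; abel
  rw [this]; abel

theorem comulRel : SL2Rel (B := SU2 q ⊗[ℂ] SU2 q) (q : ℂ)
    (a q ⊗ₜ a q + b q ⊗ₜ c q) (a q ⊗ₜ b q + b q ⊗ₜ d q)
    (c q ⊗ₜ a q + d q ⊗ₜ c q) (c q ⊗ₜ b q + d q ⊗ₜ d q) := by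
  have hq := q_ne_zero q
  constructor <;>
  simp only [mul_add, add_mul, Algebra.TensorProduct.tmul_mul_tmul, r_ba, r_ca, r_cb, r_db, r_dc,
    r_ad, r_da, TensorProduct.tmul_add, TensorProduct.add_tmul, TensorProduct.tmul_smul,
    ← TensorProduct.smul_tmul', Algebra.TensorProduct.one_def, smul_add, smul_smul] <;>
  match_scalars <;> field_simp <;> ring

/-- The coproduct `Δ`, given on the matrix of generators by `Δ(u_ij) = ∑_k u_ik ⊗ u_kj`. -/
def comul : SU2 q →ₐ[ℂ] SU2 q ⊗[ℂ] SU2 q := lift (comulRel q)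

open LaurentPolynomial in
theorem projRel : SL2Rel (B := LaurentPolynomial ℂ) (q : ℂ) (T (-1)) 0 0 (T 1) := by
  have h1 : (T (-1) : LaurentPolynomial ℂ) * T 1 = 1 := by
    rw [← T_add, neg_add_cancel, T_zero]
  have h2 : (T 1 : LaurentPolynomial ℂ) * T (-1) = 1 := by
    rw [← T_add, add_neg_cancel, T_zero]
  constructor <;> simp only [mul_zero, zero_mul, smul_zero, sub_zero, h1, h2, sub_self]

/-- The Hopf algebra map `π : ℂ_q[SU₂] → ℂ[U₁] = ℂ[t, t⁻¹]`, with `π(a) = t⁻¹`, `π(d) = t` and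
`π(b) = π(c) = 0`. -/
def proj : SU2 q →ₐ[ℂ] LaurentPolynomial ℂ := lift (projRel q)

/-- The right coaction `Δ_π = (id ⊗ π) ∘ Δ` of `ℂ[U₁]` on `ℂ_q[SU₂]`. -/
def coact : SU2 q →ₐ[ℂ] SU2 q ⊗[ℂ] LaurentPolynomial ℂ :=
  (Algebra.TensorProduct.map (AlgHom.id ℂ (SU2 q)) (proj q)).comp (comul q)

theorem coact_a : coact q (a q) = a q ⊗ₜ LaurentPolynomial.T (-1) := by
  simp [coact, comul, lift_a, proj, lift_c]
theorem coact_b : coact q (b q) = b q ⊗ₜ LaurentPolynomial.T 1 := by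
  simp [coact, comul, lift_b, proj, lift_d]
theorem coact_c : coact q (c q) = c q ⊗ₜ LaurentPolynomial.T (-1) := by
  simp [coact, comul, lift_a, proj, lift_c]
theorem coact_d : coact q (d q) = d q ⊗ₜ LaurentPolynomial.T 1 := by
  simp [coact, comul, lift_d, proj, lift_b]

/-- The degree `k` part `E_k = {f | Δ_π(f) = f ⊗ t ^ k}` of `ℂ_q[SU₂]`; the Podleś sphere `ℂ_q[S²]` is
`E_0`, and `a, c` have degree `-1` while `b, d` have degree `1`. -/
def E (k : ℤ) : Submodule ℂ (SU2 q) where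
  carrier := {f | coact q f = f ⊗ₜ[ℂ] LaurentPolynomial.T k}
  zero_mem' := by simp
  add_mem' := by
    intro f g hf hg
    simp only [Set.mem_ofPred_eq, map_add, TensorProduct.add_tmul] at *
    rw [hf, hg]
  smul_mem' := by
    intro z f hf
    simp only [Set.mem_ofPred_eq, map_smul, ← TensorProduct.smul_tmul'] at *
    rw [hf]

theorem mem_E {k : ℤ} {f : SU2 q} :
    f ∈ E q k ↔ coact q f = f ⊗ₜ[ℂ] LaurentPolynomial.T k := Iff.rfl

theorem mul_mem_E {k l m : ℤ} (h : k + l = m) {f g : SU2 q} (hf : f ∈ E q k) (hg : g ∈ E q l) :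
    f * g ∈ E q m := by
  rw [mem_E] at *
  rw [map_mul, hf, hg, Algebra.TensorProduct.tmul_mul_tmul, ← LaurentPolynomial.T_add, h]

theorem one_mem_E : (1 : SU2 q) ∈ E q 0 := by
  rw [mem_E, map_one, LaurentPolynomial.T_zero, Algebra.TensorProduct.one_def]

theorem induct {P : SU2 q → Prop} (halg : ∀ z : ℂ, P (algebraMap ℂ _ z))
    (ha : P (a q)) (hb : P (b q)) (hc : P (c q)) (hd : P (d q))
    (hadd : ∀ f g, P f → P g → P (f + g)) (hmul : ∀ f g, P f → P g → P (f * g)) (f : SU2 q) :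
    P f := by
  obtain ⟨x, rfl⟩ := RingQuot.mkAlgHom_surjective ℂ (Rel q) f
  induction x using FreeAlgebra.induction with
  | grade0 z => rw [AlgHom.commutes]; exact halg z
  | grade1 x => cases x; exacts [ha, hb, hc, hd]
  | mul x y hx hy => rw [map_mul]; exact hmul _ _ hx hy
  | add x y hx hy => rw [map_add]; exact hadd _ _ hx hy

/-- The opposite algebra of `ℂ_q[SU₂]` with the conjugate complex structure, so that algebra maps
from `ℂ_q[SU₂]` into it are the conjugate-linear antimultiplicative maps. -/
def ConjOp : Type := (SU2 q)ᵐᵒᵖ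
instance : Ring (ConjOp q) := inferInstanceAs (Ring (SU2 q)ᵐᵒᵖ)
instance : Algebra ℂ (ConjOp q) :=
  RingHom.toAlgebra' ((algebraMap ℂ (SU2 q)ᵐᵒᵖ).comp (starRingEnd ℂ))
    (fun z x => Algebra.commutes (A := (SU2 q)ᵐᵒᵖ) (starRingEnd ℂ z) x)

/-- The identity map to `ConjOp`. -/
def toConj (x : SU2 q) : ConjOp q := MulOpposite.op x
/-- The identity map from `ConjOp`. -/
def ofConj (x : ConjOp q) : SU2 q := MulOpposite.unop x
theorem toConj_mul (x y) : toConj q x * toConj q y = toConj q (y * x) := rfl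
theorem toConj_sub (x y) : toConj q x - toConj q y = toConj q (x - y) := rfl
theorem toConj_one : toConj q 1 = 1 := rfl
theorem toConj_smul (z : ℂ) (x) : z • toConj q x = toConj q (starRingEnd ℂ z • x) := by
  rw [Algebra.smul_def, Algebra.smul_def, Algebra.commutes (starRingEnd ℂ z) x]
  rfl

theorem starRel : SL2Rel (B := ConjOp q) (q : ℂ) (toConj q (d q)) (toConj q (-((q : ℂ) • c q)))
    (toConj q (-((q : ℂ)⁻¹ • b q))) (toConj q (a q)) := by
  have hq := q_ne_zero q
  constructor <;> simp only [toConj_mul, toConj_smul, toConj_sub, ← toConj_one, map_sub, map_inv₀, Complex.conj_ofReal,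
    mul_neg, neg_mul, mul_smul_comm, smul_mul_assoc, r_ba, r_ca, r_cb, r_db, r_dc, r_ad, r_da] <;>
  congr 1 <;> simp only [smul_smul, smul_neg] <;> match_scalars <;> field_simp <;> ring

/-- The `*`-map, as an algebra map to `ConjOp`. -/
def starHom : SU2 q →ₐ[ℂ] ConjOp q := lift (starRel q)

/-- The `*`-structure of `ℂ_q[SU₂]`: the conjugate-linear antimultiplicative map with `a* = d`,
`b* = -q c`, `c* = -q⁻¹ b`, `d* = a`. -/
instance : Star (SU2 q) := ⟨fun f => ofConj q (starHom q f)⟩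

theorem star_mul_rev (f g : SU2 q) : star (f * g) = star g * star f := by
  change ofConj q (starHom q (f * g)) = _
  rw [map_mul]; rfl
theorem star_smul_conj (z : ℂ) (f : SU2 q) : star (z • f) = starRingEnd ℂ z • star f := by
  change ofConj q (starHom q (z • f)) = _
  rw [map_smul]
  exact congrArg (ofConj q) (toConj_smul q z _)

/-- Upper triangular two-by-two matrices. -/
def tri (x y z : SU2 q) : Matrix (Fin 2) (Fin 2) (SU2 q) := !![x, y; 0, z]

theorem tri_mul (x y z x' y' z' : SU2 q) :
    tri q x y z * tri q x' y' z' = tri q (x * x') (x * y' + y * z') (z * z') := by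
  simp [tri]
theorem tri_add (x y z x' y' z' : SU2 q) :
    tri q x y z + tri q x' y' z' = tri q (x + x') (y + y') (z + z') := by
  ext i j; fin_cases i <;> fin_cases j <;> simp [tri]
theorem tri_sub (x y z x' y' z' : SU2 q) :
    tri q x y z - tri q x' y' z' = tri q (x - x') (y - y') (z - z') := by
  ext i j; fin_cases i <;> fin_cases j <;> simp [tri]
theorem tri_smul (r : ℂ) (x y z : SU2 q) : r • tri q x y z = tri q (r • x) (r • y) (r • z) := by
  ext i j; fin_cases i <;> fin_cases j <;> simp [tri]
theorem tri_one : (1 : Matrix (Fin 2) (Fin 2) (SU2 q)) = tri q 1 0 1 := by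
  ext i j; fin_cases i <;> fin_cases j <;> simp [tri]

theorem matRelPlus : SL2Rel (q : ℂ)
    (tri q (a q) (b q) ((q : ℂ)⁻¹ • a q)) (tri q (b q) 0 ((q : ℂ) • b q))
    (tri q (c q) (d q) ((q : ℂ)⁻¹ • c q)) (tri q (d q) 0 ((q : ℂ) • d q)) := by
  have hq := q_ne_zero q
  constructor <;>
  simp only [tri_mul, tri_smul, tri_sub, tri_one, mul_zero, zero_mul, smul_zero, add_zero,
    zero_add, mul_smul_comm, smul_mul_assoc, r_ba, r_ca, r_cb, r_db, r_dc, r_ad, r_da,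
    smul_add, smul_smul] <;>
  congr 1 <;> match_scalars <;> field_simp <;> ring

theorem matRelMinus : SL2Rel (q : ℂ)
    (tri q (a q) 0 ((q : ℂ)⁻¹ • a q)) (tri q (b q) (a q) ((q : ℂ) • b q))
    (tri q (c q) 0 ((q : ℂ)⁻¹ • c q)) (tri q (d q) (c q) ((q : ℂ) • d q)) := by
  have hq := q_ne_zero q
  constructor <;>
  simp only [tri_mul, tri_smul, tri_sub, tri_one, mul_zero, zero_mul, smul_zero, add_zero,
    zero_add, mul_smul_comm, smul_mul_assoc, r_ba, r_ca, r_cb, r_db, r_dc, r_ad, r_da,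
    smul_add, smul_smul] <;>
  congr 1 <;> match_scalars <;> field_simp <;> ring

theorem twistRel : SL2Rel (q : ℂ) ((q : ℂ)⁻¹ • a q) ((q : ℂ) • b q)
    ((q : ℂ)⁻¹ • c q) ((q : ℂ) • d q) := by
  have hq := q_ne_zero q
  constructor <;>
  simp only [mul_smul_comm, smul_mul_assoc, r_ba, r_ca, r_cb, r_db, r_dc, r_ad, r_da,
    smul_add, smul_smul] <;>
  match_scalars <;> field_simp <;> ring

/-- The automorphism that acts on `E_k` as multiplication by `q ^ k`. -/
def twist : SU2 q →ₐ[ℂ] SU2 q := lift (twistRel q)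

/-- `f ↦ (f, X₊ f; 0, twist f)`. -/
def matPlus : SU2 q →ₐ[ℂ] Matrix (Fin 2) (Fin 2) (SU2 q) := lift (matRelPlus q)
/-- `f ↦ (f, X₋ f; 0, twist f)`. -/
def matMinus : SU2 q →ₐ[ℂ] Matrix (Fin 2) (Fin 2) (SU2 q) := lift (matRelMinus q)

/-- The linear map `X₊` determined by `X₊(f g) = f X₊(g) + X₊(f) twist(g)` and `X₊ a = b`, `X₊ c = d`,
`X₊ b = X₊ d = 0` (see `XPlus_mul` and the lemmas after it). -/
def XPlus : SU2 q →ₗ[ℂ] SU2 q :=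
  Matrix.entryLinearMap ℂ (SU2 q) 0 1 ∘ₗ (matPlus q).toLinearMap
/-- The linear map `X₋` determined by `X₋(f g) = f X₋(g) + X₋(f) twist(g)` and `X₋ b = a`, `X₋ d = c`,
`X₋ a = X₋ c = 0`. -/
def XMinus : SU2 q →ₗ[ℂ] SU2 q :=
  Matrix.entryLinearMap ℂ (SU2 q) 0 1 ∘ₗ (matMinus q).toLinearMap

theorem matPlus_eq (f : SU2 q) : matPlus q f = tri q f (XPlus q f) (twist q f) := by
  refine induct q (P := fun f => matPlus q f = tri q f (XPlus q f) (twist q f))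
    ?_ ?_ ?_ ?_ ?_ ?_ ?_ f
  · intro z
    have h : matPlus q (algebraMap ℂ _ z) = tri q (algebraMap ℂ _ z) 0 (algebraMap ℂ _ z) := by
      rw [AlgHom.commutes, Algebra.algebraMap_eq_smul_one, tri_one, tri_smul, smul_zero,
        Algebra.algebraMap_eq_smul_one]
    have h' : XPlus q (algebraMap ℂ _ z) = 0 := by
      change matPlus q (algebraMap ℂ _ z) 0 1 = 0
      rw [h]; rfl
    rw [h, h', AlgHom.commutes]
  · change _ = tri q _ (matPlus q (a q) 0 1) _
    rw [matPlus, lift_a, twist, lift_a]; rfl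
  · change _ = tri q _ (matPlus q (b q) 0 1) _
    rw [matPlus, lift_b, twist, lift_b]; rfl
  · change _ = tri q _ (matPlus q (c q) 0 1) _
    rw [matPlus, lift_c, twist, lift_c]; rfl
  · change _ = tri q _ (matPlus q (d q) 0 1) _
    rw [matPlus, lift_d, twist, lift_d]; rfl
  · intro f g hf hg
    rw [map_add, map_add, map_add, hf, hg, tri_add]
  · intro f g hf hg
    have h : matPlus q (f * g) =
        tri q (f * g) (f * XPlus q g + XPlus q f * twist q g) (twist q f * twist q g) := by
      rw [map_mul, hf, hg, tri_mul]
    have h' : XPlus q (f * g) = f * XPlus q g + XPlus q f * twist q g := by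
      change matPlus q (f * g) 0 1 = _
      rw [h]; rfl
    rw [h, h', map_mul]

theorem matMinus_eq (f : SU2 q) : matMinus q f = tri q f (XMinus q f) (twist q f) := by
  refine induct q (P := fun f => matMinus q f = tri q f (XMinus q f) (twist q f))
    ?_ ?_ ?_ ?_ ?_ ?_ ?_ f
  · intro z
    have h : matMinus q (algebraMap ℂ _ z) = tri q (algebraMap ℂ _ z) 0 (algebraMap ℂ _ z) := by
      rw [AlgHom.commutes, Algebra.algebraMap_eq_smul_one, tri_one, tri_smul, smul_zero,
        Algebra.algebraMap_eq_smul_one]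
    have h' : XMinus q (algebraMap ℂ _ z) = 0 := by
      change matMinus q (algebraMap ℂ _ z) 0 1 = 0
      rw [h]; rfl
    rw [h, h', AlgHom.commutes]
  · change _ = tri q _ (matMinus q (a q) 0 1) _
    rw [matMinus, lift_a, twist, lift_a]; rfl
  · change _ = tri q _ (matMinus q (b q) 0 1) _
    rw [matMinus, lift_b, twist, lift_b]; rfl
  · change _ = tri q _ (matMinus q (c q) 0 1) _
    rw [matMinus, lift_c, twist, lift_c]; rfl
  · change _ = tri q _ (matMinus q (d q) 0 1) _
    rw [matMinus, lift_d, twist, lift_d]; rfl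
  · intro f g hf hg
    rw [map_add, map_add, map_add, hf, hg, tri_add]
  · intro f g hf hg
    have h : matMinus q (f * g) =
        tri q (f * g) (f * XMinus q g + XMinus q f * twist q g) (twist q f * twist q g) := by
      rw [map_mul, hf, hg, tri_mul]
    have h' : XMinus q (f * g) = f * XMinus q g + XMinus q f * twist q g := by
      change matMinus q (f * g) 0 1 = _
      rw [h]; rfl
    rw [h, h', map_mul]

theorem XPlus_mul (f g : SU2 q) : XPlus q (f * g) = f * XPlus q g + XPlus q f * twist q g := by
  change matPlus q (f * g) 0 1 = _
  rw [map_mul, matPlus_eq, matPlus_eq, tri_mul]; rfl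
theorem XMinus_mul (f g : SU2 q) :
    XMinus q (f * g) = f * XMinus q g + XMinus q f * twist q g := by
  change matMinus q (f * g) 0 1 = _
  rw [map_mul, matMinus_eq, matMinus_eq, tri_mul]; rfl

theorem XPlus_a : XPlus q (a q) = b q := by
  change matPlus q (a q) 0 1 = _
  rw [matPlus, lift_a]; rfl
theorem XPlus_b : XPlus q (b q) = 0 := by
  change matPlus q (b q) 0 1 = _
  rw [matPlus, lift_b]; rfl
theorem XPlus_c : XPlus q (c q) = d q := by
  change matPlus q (c q) 0 1 = _
  rw [matPlus, lift_c]; rfl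
theorem XPlus_d : XPlus q (d q) = 0 := by
  change matPlus q (d q) 0 1 = _
  rw [matPlus, lift_d]; rfl
theorem XMinus_a : XMinus q (a q) = 0 := by
  change matMinus q (a q) 0 1 = _
  rw [matMinus, lift_a]; rfl
theorem XMinus_b : XMinus q (b q) = a q := by
  change matMinus q (b q) 0 1 = _
  rw [matMinus, lift_b]; rfl
theorem XMinus_c : XMinus q (c q) = 0 := by
  change matMinus q (c q) 0 1 = _
  rw [matMinus, lift_c]; rfl
theorem XMinus_d : XMinus q (d q) = c q := by
  change matMinus q (d q) 0 1 = _
  rw [matMinus, lift_d]; rfl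

theorem coact_twist (f : SU2 q) : coact q (twist q f) =
    Algebra.TensorProduct.map (twist q) (AlgHom.id ℂ _) (coact q f) := by
  have : (coact q).comp (twist q) =
      (Algebra.TensorProduct.map (twist q) (AlgHom.id ℂ _)).comp (coact q) := by
    apply hom_ext <;>
    simp only [AlgHom.comp_apply, twist, lift_a, lift_b, lift_c, lift_d, map_smul, coact_a,
      coact_b, coact_c, coact_d, Algebra.TensorProduct.map_tmul, AlgHom.id_apply,
      TensorProduct.smul_tmul']
  exact DFunLike.congr_fun this f

/-- A twisted derivation that shifts the degree of the generators by `n` shifts all degrees by `n`. -/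
theorem coact_twistedDerivation (n : ℤ) (X : SU2 q →ₗ[ℂ] SU2 q)
    (hX : ∀ f g, X (f * g) = f * X g + X f * twist q g)
    (ha : X (a q) ∈ E q (-1 + n)) (hb : X (b q) ∈ E q (1 + n))
    (hc : X (c q) ∈ E q (-1 + n)) (hd : X (d q) ∈ E q (1 + n)) (f : SU2 q) :
    coact q (X f) =
      TensorProduct.map X (LinearMap.mulRight ℂ (LaurentPolynomial.T n)) (coact q f) := by
  have key : ∀ u v : SU2 q ⊗[ℂ] LaurentPolynomial ℂ,
      TensorProduct.map X (LinearMap.mulRight ℂ (LaurentPolynomial.T n)) (u * v) =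
        u * TensorProduct.map X (LinearMap.mulRight ℂ (LaurentPolynomial.T n)) v +
        TensorProduct.map X (LinearMap.mulRight ℂ (LaurentPolynomial.T n)) u *
          Algebra.TensorProduct.map (twist q) (AlgHom.id ℂ _) v := by
    intro u v
    induction u using TensorProduct.induction_on with
    | zero => simp
    | add x y hx hy => rw [add_mul, map_add, hx, hy, add_mul, map_add, add_mul]; abel
    | tmul x s =>
      induction v using TensorProduct.induction_on with
      | zero => simp
      | add x y hx hy => rw [mul_add, map_add, hx, hy, map_add, map_add, mul_add, mul_add]; abel
      | tmul y t =>
        simp only [Algebra.TensorProduct.tmul_mul_tmul, TensorProduct.map_tmul,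
          LinearMap.mulRight_apply, Algebra.TensorProduct.map_tmul, AlgHom.id_apply, hX,
          TensorProduct.add_tmul]
        rw [mul_assoc, mul_right_comm s, mul_assoc s]
  refine induct q (P := fun f => coact q (X f) =
      TensorProduct.map X (LinearMap.mulRight ℂ (LaurentPolynomial.T n)) (coact q f))
    ?_ ?_ ?_ ?_ ?_ ?_ ?_ f
  · intro z
    have h1 : X 1 = 0 := by
      have := hX 1 1
      rw [map_one (twist q), mul_one, one_mul, mul_one] at this
      simpa using this
    rw [Algebra.algebraMap_eq_smul_one, map_smul, map_smul, map_smul, map_smul, map_one (coact q),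
      Algebra.TensorProduct.one_def, TensorProduct.map_tmul, h1, map_zero,
      TensorProduct.zero_tmul]
  · rw [ha, coact_a, LaurentPolynomial.T_add]; rfl
  · rw [hb, coact_b, LaurentPolynomial.T_add]; rfl
  · rw [hc, coact_c, LaurentPolynomial.T_add]; rfl
  · rw [hd, coact_d, LaurentPolynomial.T_add]; rfl
  · intro f g hf hg
    rw [map_add, map_add, map_add, map_add, hf, hg]
  · intro f g hf hg
    rw [hX, map_add, map_mul, map_mul, map_mul, key, hf, hg, coact_twist]

theorem XPlus_mem {k l : ℤ} (h : k + 2 = l) {f : SU2 q} (hf : f ∈ E q k) : XPlus q f ∈ E q l := by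
  have := coact_twistedDerivation q 2 (XPlus q) (XPlus_mul q)
    (by rw [XPlus_a]; exact coact_b q) (by rw [XPlus_b]; exact zero_mem _)
    (by rw [XPlus_c]; exact coact_d q) (by rw [XPlus_d]; exact zero_mem _) f
  rw [mem_E, this, hf, TensorProduct.map_tmul, LinearMap.mulRight_apply,
    ← LaurentPolynomial.T_add, h]
theorem XMinus_mem {k l : ℤ} (h : k - 2 = l) {f : SU2 q} (hf : f ∈ E q k) :
    XMinus q f ∈ E q l := by
  have := coact_twistedDerivation q (-2) (XMinus q) (XMinus_mul q)
    (by rw [XMinus_a]; exact zero_mem _) (by rw [XMinus_b]; exact coact_a q)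
    (by rw [XMinus_c]; exact zero_mem _) (by rw [XMinus_d]; exact coact_c q) f
  rw [mem_E, this, hf, TensorProduct.map_tmul, LinearMap.mulRight_apply,
    ← LaurentPolynomial.T_add, ← sub_eq_add_neg, h]

/-- `D₊ = q⁻¹ X₊ : E_k → E_{k+2}`. On `ℂ_q[S²]` one has `∂ f = D₊(f) e⁺`; the factor is the one for
which `e⁺` is the class of `d b₊`, that is, `∂ b₊ = d² e⁺` for `b₊ = c d`. -/
def DPlus (k l : ℤ) (h : k + 2 = l) : E q k →ₗ[ℂ] E q l :=
  (q : ℂ)⁻¹ • (XPlus q).restrict (fun _ hf => XPlus_mem q h hf)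
/-- `D₋ = -i q X₋ : E_k → E_{k-2}`. On `ℂ_q[S²]` one has `∂̄ f = D₋(f) e⁻`. The basis element `e⁻` is
`i q⁻¹` times the class of `d b₋`, `b₋ = a b`; then `(e⁺)* = i e⁻`, `(e⁻)* = i e⁺`, and the volume form
`e⁺ ∧ e⁻` is `*`-invariant. -/
def DMinus (k l : ℤ) (h : k - 2 = l) : E q k →ₗ[ℂ] E q l :=
  (-Complex.I * (q : ℂ)) • (XMinus q).restrict (fun _ hf => XMinus_mem q h hf)

/-- The differential forms `Ω^•_q(S²)`. The quadruple `(f, F, G, k)` stands for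
`f + F e⁺ + G e⁻ + k e⁺ ∧ e⁻`, that is, `Ω⁰ = ℂ_q[S²]`, `Ω^(1,0) = E_2 e⁺`, `Ω^(0,1) = E_{-2} e⁻` and
`Ω² = Ω^(1,1) = ℂ_q[S²] e⁺ ∧ e⁻`. -/
abbrev Forms : Type := E q 0 × E q 2 × E q (-2) × E q 0

/-- The product of forms: `F e⁺ ∧ G e⁻ = F G e⁺ ∧ e⁻`, `G e⁻ ∧ F e⁺ = -q² G F e⁺ ∧ e⁻`,
`F e⁺ ∧ F' e⁺ = 0`, `G e⁻ ∧ G' e⁻ = 0`, and functions multiply coefficients from either side. -/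
def wedge (ω ν : Forms q) : Forms q :=
  (⟨ω.1 * ν.1, mul_mem_E q (by norm_num) ω.1.2 ν.1.2⟩,
   ⟨ω.1 * ν.2.1, mul_mem_E q (by norm_num) ω.1.2 ν.2.1.2⟩ +
     ⟨ω.2.1 * ν.1, mul_mem_E q (by norm_num) ω.2.1.2 ν.1.2⟩,
   ⟨ω.1 * ν.2.2.1, mul_mem_E q (by norm_num) ω.1.2 ν.2.2.1.2⟩ +
     ⟨ω.2.2.1 * ν.1, mul_mem_E q (by norm_num) ω.2.2.1.2 ν.1.2⟩,
   ⟨ω.1 * ν.2.2.2, mul_mem_E q (by norm_num) ω.1.2 ν.2.2.2.2⟩ +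
     ⟨ω.2.2.2 * ν.1, mul_mem_E q (by norm_num) ω.2.2.2.2 ν.1.2⟩ +
     ⟨ω.2.1 * ν.2.2.1, mul_mem_E q (by norm_num) ω.2.1.2 ν.2.2.1.2⟩ -
     (q : ℂ) ^ 2 • ⟨ω.2.2.1 * ν.2.1, mul_mem_E q (by norm_num) ω.2.2.1.2 ν.2.1.2⟩)

theorem wedge_add_left (ω ω₂ ν : Forms q) :
    wedge q (ω + ω₂) ν = wedge q ω ν + wedge q ω₂ ν := by
  refine Prod.ext ?_ (Prod.ext ?_ (Prod.ext ?_ ?_)) <;> apply Subtype.ext <;>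
  simp only [wedge, Prod.fst_add, Prod.snd_add, Submodule.coe_add, Submodule.coe_sub,
    Submodule.coe_smul, add_mul, smul_add] <;> abel

theorem wedge_smul_left (z : ℂ) (ω ν : Forms q) : wedge q (z • ω) ν = z • wedge q ω ν := by
  refine Prod.ext ?_ (Prod.ext ?_ (Prod.ext ?_ ?_)) <;> apply Subtype.ext <;>
  simp only [wedge, Prod.smul_fst, Prod.smul_snd, Submodule.coe_add, Submodule.coe_sub,
    Submodule.coe_smul, smul_mul_assoc, smul_add, smul_sub, smul_comm z]

/-- `∂`: on functions `∂ f = D₊(f) e⁺`, and `∂ (G e⁻) = q² D₊(G) e⁺ ∧ e⁻`, the value forced by the graded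
Leibniz rule. -/
def del : Module.End ℂ (Forms q) where
  toFun ω := (0, DPlus q 0 2 (by norm_num) ω.1, 0,
    (q : ℂ) ^ 2 • DPlus q (-2) 0 (by norm_num) ω.2.2.1)
  map_add' ω ν := by
    simp only [Prod.fst_add, Prod.snd_add, map_add, smul_add, Prod.mk_add_mk, add_zero]
  map_smul' z ω := by
    simp only [Prod.smul_fst, Prod.smul_snd, map_smul, Prod.smul_mk, smul_zero, RingHom.id_apply,
      smul_comm z]

/-- `∂̄`: on functions `∂̄ f = D₋(f) e⁻`, and `∂̄ (F e⁺) = -D₋(F) e⁺ ∧ e⁻`, the value forced by the graded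
Leibniz rule. -/
def delbar : Module.End ℂ (Forms q) where
  toFun ω := (0, 0, DMinus q 0 (-2) (by norm_num) ω.1, -DMinus q 2 0 (by norm_num) ω.2.1)
  map_add' ω ν := by
    simp only [Prod.fst_add, Prod.snd_add, map_add, neg_add, Prod.mk_add_mk, add_zero]
  map_smul' z ω := by
    simp only [Prod.smul_fst, Prod.smul_snd, map_smul, Prod.smul_mk, smul_zero, RingHom.id_apply,
      smul_neg]

/-- The fundamental form `κ = -e⁺ ∧ e⁻`. -/
def kappa : Forms q := (0, 0, 0, -⟨1, one_mem_E q⟩)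

/-- The Lefschetz operator `L ω = ω ∧ κ`. -/
def lefschetz : Module.End ℂ (Forms q) where
  toFun ω := wedge q ω (kappa q)
  map_add' ω ν := wedge_add_left q ω ν (kappa q)
  map_smul' z ω := wedge_smul_left q z ω (kappa q)

/-- `h` is the Haar functional of `ℂ_q[SU₂]`: normalised, and invariant on both sides. -/
structure IsHaar (h : SU2 q →ₗ[ℂ] ℂ) : Prop where
  map_one : h 1 = 1
  left_invariant : ∀ f,
    TensorProduct.rid ℂ (SU2 q) (LinearMap.lTensor (SU2 q) h (comul q f)) = h f • 1
  right_invariant : ∀ f,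
    TensorProduct.lid ℂ (SU2 q) (LinearMap.rTensor (SU2 q) h (comul q f)) = h f • 1

/-- The metric `g`, conjugate-linear in the second variable: `g(f, f') = f f'*`,
`g(F e⁺, F' e⁺) = F F'*`, `g(G e⁻, G' e⁻) = q² G G'*`, `g(k e⁺ ∧ e⁻, k' e⁺ ∧ e⁻) = k k'*`, and the four
summands are orthogonal. Equivalently `g(ω, ν) e⁺ ∧ e⁻ = ω ∧ *_H(ν*)` (in top degree) for the Hodge map
with `*_H(1) = e⁺ ∧ e⁻`, `*_H(e⁺ ∧ e⁻) = 1`, `*_H(e^±) = ± i e^±`. -/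
def metric (ω ν : Forms q) : SU2 q :=
  ω.1 * star (ν.1 : SU2 q) + ω.2.1 * star (ν.2.1 : SU2 q) +
    (q : ℂ) ^ 2 • (ω.2.2.1 * star (ν.2.2.1 : SU2 q)) + ω.2.2.2 * star (ν.2.2.2 : SU2 q)

/-- The inner product `⟨ω, ν⟩ = ∫ g(ω, ν) e⁺ ∧ e⁻`, where `∫ f e⁺ ∧ e⁻ = h(f)`. -/
def innerProd (h : SU2 q →ₗ[ℂ] ℂ) (ω ν : Forms q) : ℂ := h (metric q ω ν)

/-- `S` is an adjoint of `T` for the inner product. -/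
def IsAdjoint (h : SU2 q →ₗ[ℂ] ℂ) (T S : Module.End ℂ (Forms q)) : Prop :=
  ∀ ω ν, innerProd q h (T ω) ν = innerProd q h ω (S ν)

end
end PodlesSphere

/-! Once the adjoints are explicit the identities are easy: `L`, `∂`, `∂̄` and their adjoints act on
coefficients by multiples of the identity, `X₊` and `X₋`, and each identity compares scalars,
without commuting `X₊` past `X₋`. The substance lies in the Haar functional: its existence, its
integration by parts, and its nondegeneracy.

Existence. The maps `X₊`, `X₋` satisfy a `q`-deformed `sl₂` relation on each `E_k` (`XPlus_XMinus`).
If `X₊ g = 1` with `g` of degree `-2`, this gives `X₊ X₋^(m+1) g = r_m X₋^m g` with all `r_m < 0`;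
since `X₋` is locally nilpotent, descent forces `g = 0`. Hence `1` is outside the range of `X₊`
(`one_notMem_range_XPlus`), while `1`, that range and the nonzero degrees span everything
(`eq_top_of_range_XPlus_le`). A normalised functional killing the last two is left invariant,
because `X₊` and the grading act on the second leg of the coproduct. The symmetry `b ↔ c` turns it
into a right invariant functional, and the two must coincide (`exists_isHaar`).

Adjoints. Invariance gives `h ∘ X₊ = h ∘ X₋ = 0`. With the twisted Leibniz rule and the formula for
`X₊(f*)`, this makes `q² X₋` adjoint to `X₊`, in every degree alike.

Uniqueness of adjoints. The radical `R` of `(f, g) ↦ h(fg)` is a left ideal with `Δ(R) ⊆ A ⊗ R`,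
where `A` is the whole algebra. So `S(x₁)x₂ = ε(x)1` lies in `R` for `x ∈ R`, which forces `ε(x) =
0`, and then `x = x₁ε(x₂) = 0`. No positivity of `h` is needed. -/

namespace PodlesSphere
noncomputable section
variable (q : ℝˣ)

/-! ### The grading and induction over homogeneous elements. -/

/-- The projection of `ℂ_q[SU₂]` onto its degree `k` part. -/
def homProj (k : ℤ) : SU2 q →ₗ[ℂ] SU2 q :=
  (TensorProduct.rid ℂ (SU2 q)).toLinearMap ∘ₗ
    LinearMap.lTensor (SU2 q)
      (Finsupp.lapply k ∘ₗ (AddMonoidAlgebra.coeffLinearEquiv ℂ).toLinearMap) ∘ₗ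
    (coact q).toLinearMap

variable {q}

theorem homProj_of_mem {k l : ℤ} {f : SU2 q} (hf : f ∈ E q l) :
    homProj q k f = if l = k then f else 0 := by
  rw [mem_E] at hf
  have : (LaurentPolynomial.T l : LaurentPolynomial ℂ).coeff k = if l = k then 1 else 0 :=
    LaurentPolynomial.T_apply k l
  simp [homProj, hf, this]

theorem homProj_self {k : ℤ} {f : SU2 q} (hf : f ∈ E q k) : homProj q k f = f := by
  rw [homProj_of_mem hf, if_pos rfl]

theorem a_mem_E : a q ∈ E q (-1) := coact_a q
theorem b_mem_E : b q ∈ E q 1 := coact_b q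
theorem c_mem_E : c q ∈ E q (-1) := coact_c q
theorem d_mem_E : d q ∈ E q 1 := coact_d q

/-- A family of subspaces that contains the generators in the right degrees and is closed under
multiplication spans everything. -/
theorem iSup_eq_top_of_generators (G : ℤ → Submodule ℂ (SU2 q)) (h1 : 1 ∈ G 0)
    (ha : a q ∈ G (-1)) (hb : b q ∈ G 1) (hc : c q ∈ G (-1)) (hd : d q ∈ G 1)
    (hmul : ∀ k l f g, f ∈ G k → g ∈ G l → f * g ∈ G (k + l)) : ⨆ k, G k = ⊤ := by
  have hle : ∀ k, G k ≤ ⨆ k, G k := le_iSup G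
  rw [eq_top_iff]
  rintro f -
  refine induct q (P := fun f => f ∈ ⨆ k, G k) ?_ (hle _ ha) (hle _ hb) (hle _ hc) (hle _ hd)
    (fun _ _ => add_mem) ?_ f
  · intro z
    rw [Algebra.algebraMap_eq_smul_one]
    exact Submodule.smul_mem _ _ (hle _ h1)
  · intro f g hf hg
    refine Submodule.iSup_induction G (motive := fun f => f * g ∈ ⨆ k, G k) hf ?_ (by simp) ?_
    · intro k f hf
      refine Submodule.iSup_induction G (motive := fun g => f * g ∈ ⨆ k, G k) hg ?_ (by simp) ?_
      · intro l g hg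
        exact hle _ (hmul k l f g hf hg)
      · intro x y hx hy
        rw [mul_add]; exact add_mem hx hy
    · intro x y hx hy
      rw [add_mul]; exact add_mem hx hy

theorem iSup_E : ⨆ k, E q k = ⊤ :=
  iSup_eq_top_of_generators _ (one_mem_E q) a_mem_E b_mem_E c_mem_E d_mem_E
    fun _ _ _ _ hf hg => mul_mem_E q rfl hf hg

/-- The projection to degree `k` kills every `G l` with `l ≠ k`, so an element of `E q k` lies in `G
k` as soon as the `G l` span. Taking `G k` to be the elements of `E q k` with a property depending
on `k` reduces that property to generators and products. -/
theorem E_le_of_generators (G : ℤ → Submodule ℂ (SU2 q)) (hG : ∀ k, G k ≤ E q k) (h1 : 1 ∈ G 0)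
    (ha : a q ∈ G (-1)) (hb : b q ∈ G 1) (hc : c q ∈ G (-1)) (hd : d q ∈ G 1)
    (hmul : ∀ k l f g, f ∈ G k → g ∈ G l → f * g ∈ G (k + l)) (k : ℤ) : E q k ≤ G k := by
  intro f hf
  have hmem : f ∈ ⨆ k, G k := by
    rw [iSup_eq_top_of_generators G h1 ha hb hc hd hmul]; trivial
  rw [← homProj_self hf]
  refine Submodule.iSup_induction G (motive := fun f => homProj q k f ∈ G k) hmem ?_ (by simp) ?_
  · intro l x hx
    rw [homProj_of_mem (hG l hx)]
    split_ifs with h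
    · rwa [← h]
    · exact zero_mem _
  · intro x y hx hy
    rw [map_add]; exact add_mem hx hy

theorem induct_E {P : SU2 q → Prop} (hE : ∀ k, ∀ f ∈ E q k, P f)
    (hadd : ∀ f g, P f → P g → P (f + g)) (f : SU2 q) : P f :=
  Submodule.iSup_induction (E q) (motive := P) (by rw [iSup_E]; trivial) hE
    (hE 0 0 (zero_mem _)) hadd

theorem ext_E {M : Type*} [AddCommGroup M] [Module ℂ M] {S T : SU2 q →ₗ[ℂ] M}
    (h : ∀ k, ∀ f ∈ E q k, S f = T f) (f : SU2 q) : S f = T f :=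
  induct_E (P := fun f => S f = T f) h
    (fun f g hf hg => by rw [map_add, map_add, hf, hg]) f

theorem homProj_mem (k : ℤ) (f : SU2 q) : homProj q k f ∈ E q k := by
  refine induct_E (P := fun f => homProj q k f ∈ E q k) ?_ ?_ f
  · intro l f hf
    rw [homProj_of_mem hf]
    split_ifs with h
    · rwa [← h]
    · exact zero_mem _
  · intro f g hf hg
    rw [map_add]; exact add_mem hf hg

theorem twist_of_mem {k : ℤ} {f : SU2 q} (hf : f ∈ E q k) : twist q f = (q : ℂ) ^ k • f := by
  have hq := q_ne_zero q
  have := E_le_of_generators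
    (fun k => E q k ⊓ LinearMap.ker ((twist q).toLinearMap - (q : ℂ) ^ k • LinearMap.id))
    (fun k => inf_le_left) ⟨one_mem_E q, by simp⟩
    ⟨a_mem_E, by simp [twist, lift_a]⟩ ⟨b_mem_E, by simp [twist, lift_b]⟩
    ⟨c_mem_E, by simp [twist, lift_c]⟩ ⟨d_mem_E, by simp [twist, lift_d]⟩ ?_ k hf
  · simpa [sub_eq_zero] using this.2
  · rintro k l f g ⟨hf, hf'⟩ ⟨hg, hg'⟩
    replace hf' : twist q f = (q : ℂ) ^ k • f := sub_eq_zero.1 hf'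
    replace hg' : twist q g = (q : ℂ) ^ l • g := sub_eq_zero.1 hg'
    refine ⟨mul_mem_E q rfl hf hg,
      sub_eq_zero.2 (?_ : twist q (f * g) = (q : ℂ) ^ (k + l) • (f * g))⟩
    rw [map_mul, hf', hg', smul_mul_smul_comm, zpow_add₀ hq]

theorem XPlus_mul_of_mem (f : SU2 q) {k : ℤ} {g : SU2 q} (hg : g ∈ E q k) :
    XPlus q (f * g) = f * XPlus q g + (q : ℂ) ^ k • (XPlus q f * g) := by
  rw [XPlus_mul, twist_of_mem hg, mul_smul_comm]
theorem XMinus_mul_of_mem (f : SU2 q) {k : ℤ} {g : SU2 q} (hg : g ∈ E q k) :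
    XMinus q (f * g) = f * XMinus q g + (q : ℂ) ^ k • (XMinus q f * g) := by
  rw [XMinus_mul, twist_of_mem hg, mul_smul_comm]

theorem XPlus_one : XPlus q 1 = 0 := by
  have := XPlus_mul q 1 1
  rw [map_one (twist q), mul_one, one_mul, mul_one] at this
  simpa using this
theorem XMinus_one : XMinus q 1 = 0 := by
  have := XMinus_mul q 1 1
  rw [map_one (twist q), mul_one, one_mul, mul_one] at this
  simpa using this

/-! ### `q`-integers and the commutation relation of `X₊` and `X₋`. -/

variable (q) in
/-- The `q`-integer `(q ^ (2 k) - 1) / (q ^ 2 - 1)`. -/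
def qInt (k : ℤ) : ℝ := if (q : ℝ) ^ 2 = 1 then k else ((q : ℝ) ^ (2 * k) - 1) / ((q : ℝ) ^ 2 - 1)

/-- This asymmetric form is the one produced by the twisted Leibniz rule: the left factor of a
product picks up `q ^ l` twice. -/
theorem qInt_add (k l : ℤ) : qInt q (k + l) = qInt q l + (q : ℝ) ^ (2 * l) * qInt q k := by
  have hq := q.ne_zero
  unfold qInt
  split_ifs with h
  · rw [zpow_mul, zpow_ofNat, h, one_zpow]; push_cast; ring
  · have : (q : ℝ) ^ 2 - 1 ≠ 0 := sub_ne_zero.2 h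
    rw [mul_add, zpow_add₀ hq]
    field_simp; ring

theorem qInt_zero : qInt q 0 = 0 := by simp [qInt]

theorem qInt_one : qInt q 1 = 1 := by
  unfold qInt
  split_ifs with h
  · simp
  · have : (q : ℝ) ^ 2 - 1 ≠ 0 := sub_ne_zero.2 h
    rw [mul_one, zpow_ofNat, div_self this]

theorem qInt_neg_one : qInt q (-1) = -((q : ℝ) ^ 2)⁻¹ := by
  have h := qInt_add (q := q) 1 (-1)
  rw [add_neg_cancel, qInt_zero, qInt_one] at h
  have : (q : ℝ) ^ (2 * -1 : ℤ) = ((q : ℝ) ^ 2)⁻¹ := by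
    rw [mul_neg_one, zpow_neg, zpow_ofNat]
  rw [this] at h
  linarith

theorem qInt_neg_succ_neg (n : ℕ) : qInt q (-(n + 1 : ℕ)) < 0 := by
  have hq := q.ne_zero
  induction n with
  | zero =>
    have : 0 < ((q : ℝ) ^ 2)⁻¹ := by positivity
    simpa [qInt_neg_one] using this
  | succ n ih =>
    have h := qInt_add (q := q) (-(n + 1 : ℕ)) (-1)
    have h1 : (-(n + 1 : ℕ) + -1 : ℤ) = -(n + 1 + 1 : ℕ) := by push_cast; ring
    rw [h1, qInt_neg_one] at h
    have h2 : 0 < (q : ℝ) ^ (2 * -1 : ℤ) := by rw [zpow_mul, zpow_ofNat]; positivity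
    have h3 : 0 < ((q : ℝ) ^ 2)⁻¹ := by positivity
    rw [h]
    exact add_neg (neg_lt_zero.2 h3) (mul_neg_of_pos_of_neg h2 ih)

/-- In the expansion of both sides on a product, the factor `q⁻²` makes the mixed terms `X₊f X₋g`
and `X₋f X₊g` cancel; the rest is `qInt_add`. -/
theorem XPlus_XMinus {k : ℤ} {f : SU2 q} (hf : f ∈ E q k) :
    XPlus q (XMinus q f) = ((q : ℂ) ^ 2)⁻¹ • XMinus q (XPlus q f) + (qInt q k : ℂ) • f := by
  have hq := q_ne_zero q
  have := E_le_of_generators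
    (fun k => E q k ⊓ LinearMap.ker (XPlus q ∘ₗ XMinus q -
      (((q : ℂ) ^ 2)⁻¹ • XMinus q ∘ₗ XPlus q + (qInt q k : ℂ) • LinearMap.id)))
    (fun k => inf_le_left) ⟨one_mem_E q, by simp [XPlus_one, XMinus_one, qInt_zero]⟩
    ⟨a_mem_E, by simp [XPlus_a, XMinus_a, XMinus_b, qInt_neg_one]⟩
    ⟨b_mem_E, by simp [XPlus_a, XPlus_b, XMinus_b, qInt_one]⟩
    ⟨c_mem_E, by simp [XPlus_c, XMinus_c, XMinus_d, qInt_neg_one]⟩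
    ⟨d_mem_E, by simp [XPlus_c, XPlus_d, XMinus_d, qInt_one]⟩ ?_ k hf
  · simpa [sub_eq_zero] using this.2
  · rintro k l f g ⟨hf, hf'⟩ ⟨hg, hg'⟩
    replace hf' : XPlus q (XMinus q f) =
      ((q : ℂ) ^ 2)⁻¹ • XMinus q (XPlus q f) + (qInt q k : ℂ) • f := sub_eq_zero.1 hf'
    replace hg' : XPlus q (XMinus q g) =
      ((q : ℂ) ^ 2)⁻¹ • XMinus q (XPlus q g) + (qInt q l : ℂ) • g := sub_eq_zero.1 hg'
    refine ⟨mul_mem_E q rfl hf hg, sub_eq_zero.2 (?_ : XPlus q (XMinus q (f * g)) =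
      ((q : ℂ) ^ 2)⁻¹ • XMinus q (XPlus q (f * g)) + (qInt q (k + l) : ℂ) • (f * g))⟩
    rw [XMinus_mul_of_mem f hg, map_add, map_smul, XPlus_mul_of_mem f (XMinus_mem q rfl hg),
      XPlus_mul_of_mem _ hg, XPlus_mul_of_mem f hg, map_add, map_smul,
      XMinus_mul_of_mem f (XPlus_mem q rfl hg), XMinus_mul_of_mem _ hg, hf', hg', qInt_add,
      zpow_mul, zpow_ofNat]
    have h1 : (q : ℂ) ^ (l - 2) = (q : ℂ) ^ l * ((q : ℂ) ^ 2)⁻¹ := by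
      rw [zpow_sub₀ hq, zpow_ofNat, div_eq_mul_inv]
    have h2 : (q : ℂ) ^ (l + 2) = (q : ℂ) ^ l * (q : ℂ) ^ 2 := by
      rw [zpow_add₀ hq, zpow_ofNat]
    have h3 : ((((q : ℝ) ^ 2) ^ l : ℝ) : ℂ) = (q : ℂ) ^ l * (q : ℂ) ^ l := by
      rw [← zpow_ofNat, ← zpow_mul, two_mul, zpow_add₀ (by exact_mod_cast hq)]; push_cast; rfl
    rw [h1, h2]
    push_cast [h3]
    simp only [mul_add, add_mul, smul_add, mul_smul_comm, smul_mul_assoc, smul_smul]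
    match_scalars <;> field_simp

/-! ### Local nilpotency of `X₋`, and why `1` is not in the range of `X₊`. -/

theorem XMinus_twist (f : SU2 q) : XMinus q (twist q f) = (q : ℂ) ^ 2 • twist q (XMinus q f) := by
  have hq := q_ne_zero q
  refine ext_E (S := XMinus q ∘ₗ (twist q).toLinearMap)
    (T := (q : ℂ) ^ 2 • (twist q).toLinearMap ∘ₗ XMinus q) (fun k f hf => ?_) f
  simp only [LinearMap.comp_apply, LinearMap.smul_apply, AlgHom.toLinearMap_apply]
  rw [twist_of_mem hf, twist_of_mem (XMinus_mem q rfl hf), map_smul, smul_smul, zpow_sub₀ hq,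
    zpow_ofNat, mul_div_cancel₀ _ (pow_ne_zero 2 hq)]

theorem XMinus_pow_twist (n : ℕ) {f : SU2 q} (hf : (XMinus q ^ n) f = 0) :
    (XMinus q ^ n) (twist q f) = 0 := by
  have : ∀ n, (XMinus q ^ n) (twist q f) = ((q : ℂ) ^ 2) ^ n • twist q ((XMinus q ^ n) f) := by
    intro n
    induction n with
    | zero => simp
    | succ n ih =>
      rw [pow_succ' (XMinus q), Module.End.mul_apply, ih, map_smul, XMinus_twist, smul_smul,
        Module.End.mul_apply, ← pow_succ]
  rw [this, hf, map_zero, smul_zero]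

/-- One application of `X₋` to a product lowers the nilpotency order of one factor in each term. The
bound `n + m ≤ s` leaves room for the induction on `s` alone. -/
theorem XMinus_pow_mul (s n m : ℕ) (f g : SU2 q) (hs : n + m ≤ s) (hf : (XMinus q ^ n) f = 0)
    (hg : (XMinus q ^ m) g = 0) : (XMinus q ^ s) (f * g) = 0 := by
  induction s generalizing n m f g with
  | zero =>
    obtain rfl : n = 0 := by omega
    have : f = 0 := by simpa using hf
    simp [this]
  | succ s ih =>
    rcases n with _ | n
    · have : f = 0 := by simpa using hf
      simp [this]
    rcases m with _ | m
    · have : g = 0 := by simpa using hg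
      simp [this]
    rw [pow_succ, Module.End.mul_apply, XMinus_mul, map_add,
      ih (n + 1) m f _ (by omega) hf (by rwa [pow_succ, Module.End.mul_apply] at hg),
      ih n (m + 1) _ _ (by omega) (by rwa [pow_succ, Module.End.mul_apply] at hf)
        (XMinus_pow_twist _ hg), add_zero]

/-- `X₋` is locally nilpotent. -/
theorem exists_XMinus_pow_eq_zero (f : SU2 q) : ∃ n, (XMinus q ^ n) f = 0 := by
  refine induct q (P := fun f => ∃ n, (XMinus q ^ n) f = 0) ?_ ⟨1, by simp [XMinus_a]⟩
    ⟨2, by simp [pow_two, XMinus_a, XMinus_b]⟩ ⟨1, by simp [XMinus_c]⟩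
    ⟨2, by simp [pow_two, XMinus_c, XMinus_d]⟩ ?_ ?_ f
  · intro z
    exact ⟨1, by simp [Algebra.algebraMap_eq_smul_one, XMinus_one]⟩
  · rintro f g ⟨n, hn⟩ ⟨m, hm⟩
    refine ⟨n + m, ?_⟩
    rw [map_add, pow_add, Module.End.mul_apply, Module.End.mul_apply, hm, map_zero, add_zero,
      ← Module.End.mul_apply, ← pow_add, add_comm, pow_add, Module.End.mul_apply, hn, map_zero]
  · rintro f g ⟨n, hn⟩ ⟨m, hm⟩
    exact ⟨n + m, XMinus_pow_mul _ n m f g le_rfl hn hm⟩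

theorem counitRel : SL2Rel (B := ℂ) (q : ℂ) 1 0 0 1 := by
  constructor <;> simp

variable (q) in
/-- The counit of `ℂ_q[SU₂]`. -/
def counit : SU2 q →ₐ[ℂ] ℂ := lift (counitRel (q := q))

theorem one_ne_zero_SU2 : (1 : SU2 q) ≠ 0 := by
  intro h
  have := congrArg (counit q) h
  rw [map_one, map_zero] at this
  exact one_ne_zero this

theorem XMinus_pow_mem (m : ℕ) {k : ℤ} {g : SU2 q} (hg : g ∈ E q k) :
    (XMinus q ^ m) g ∈ E q (k - 2 * m) := by
  induction m with
  | zero => simpa using hg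
  | succ m ih =>
    rw [pow_succ', Module.End.mul_apply]
    exact XMinus_mem q (by push_cast; ring) ih

theorem homProj_XPlus {k l : ℤ} (h : k + 2 = l) (f : SU2 q) :
    homProj q l (XPlus q f) = XPlus q (homProj q k f) := by
  refine ext_E (S := homProj q l ∘ₗ XPlus q) (T := XPlus q ∘ₗ homProj q k) (fun m f hf => ?_) f
  simp only [LinearMap.comp_apply]
  rw [homProj_of_mem hf, homProj_of_mem (XPlus_mem q rfl hf)]
  split_ifs with h1 h2 h2
  · rfl
  · omega
  · omega
  · rw [map_zero]

/-- A preimage of `1` would generate an infinite chain under `X₋`, as all weights met there are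
negative; local nilpotency forbids this. -/
theorem one_notMem_range_XPlus : (1 : SU2 q) ∉ LinearMap.range (XPlus q) := by
  rintro ⟨g', hg'⟩
  obtain ⟨g, hgE, hg⟩ : ∃ g ∈ E q (-2), XPlus q g = 1 := by
    refine ⟨homProj q (-2) g', homProj_mem _ _, ?_⟩
    rw [← homProj_XPlus (l := 0) (by norm_num), hg', homProj_self (one_mem_E q)]
  have hq := q.ne_zero
  -- The scalars satisfy `r₀ = [-2]` and `r_(m+1) = q⁻² r_m + [-2 - 2(m+1)]`, so they stay negative
  -- and never vanish.
  have key : ∀ m : ℕ, ∃ r : ℝ, r < 0 ∧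
      XPlus q ((XMinus q ^ (m + 1)) g) = (r : ℂ) • (XMinus q ^ m) g := by
    intro m
    induction m with
    | zero =>
      refine ⟨qInt q (-2), qInt_neg_succ_neg 1, ?_⟩
      rw [zero_add, pow_one, XPlus_XMinus hgE, hg, XMinus_one, smul_zero, zero_add, pow_zero,
        Module.End.one_apply]
    | succ m ih =>
      obtain ⟨r, hr, h⟩ := ih
      refine ⟨((q : ℝ) ^ 2)⁻¹ * r + qInt q (-2 - 2 * (m + 1 : ℕ)), ?_, ?_⟩
      · have h1 := mul_neg_of_pos_of_neg (show 0 < ((q : ℝ) ^ 2)⁻¹ by positivity) hr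
        have h2 := qInt_neg_succ_neg (q := q) (2 * m + 3)
        have h3 : (-(2 * m + 3 + 1 : ℕ) : ℤ) = -2 - 2 * (m + 1 : ℕ) := by push_cast; ring
        rw [h3] at h2
        linarith
      · rw [pow_succ', Module.End.mul_apply, XPlus_XMinus (XMinus_pow_mem (m + 1) hgE), h,
          map_smul, smul_smul, ← Module.End.mul_apply, ← pow_succ', ← add_smul]
        push_cast
        rfl
  obtain ⟨n, hn⟩ := exists_XMinus_pow_eq_zero g
  -- Descent: `X₋^(m+1) g = 0` gives `r_m X₋^m g = 0`, down to `m = 0`.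
  have hg0 : g = 0 := by
    induction n with
    | zero => simpa using hn
    | succ m ih =>
      obtain ⟨r, hr, h⟩ := key m
      rw [hn, map_zero] at h
      exact ih ((smul_eq_zero.1 h.symm).resolve_left (by exact_mod_cast hr.ne))
  rw [hg0, map_zero] at hg
  exact one_ne_zero_SU2 hg.symm

end
end PodlesSphere

/-! ### Compatibility of the derivations and of the grading with the coproduct. -/

namespace PodlesSphere
noncomputable section
variable {q : ℝˣ}

theorem comul_a : comul q (a q) = a q ⊗ₜ a q + b q ⊗ₜ c q := lift_a _
theorem comul_b : comul q (b q) = a q ⊗ₜ b q + b q ⊗ₜ d q := lift_b _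
theorem comul_c : comul q (c q) = c q ⊗ₜ a q + d q ⊗ₜ c q := lift_c _
theorem comul_d : comul q (d q) = c q ⊗ₜ b q + d q ⊗ₜ d q := lift_d _

theorem comul_twist (f : SU2 q) : comul q (twist q f) =
    Algebra.TensorProduct.map (AlgHom.id ℂ _) (twist q) (comul q f) := by
  have : (comul q).comp (twist q) =
      (Algebra.TensorProduct.map (AlgHom.id ℂ _) (twist q)).comp (comul q) := by
    apply hom_ext <;>
    simp [twist, lift_a, lift_b, lift_c, lift_d, comul_a, comul_b, comul_c, comul_d,
      -Complex.coe_smul]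
  exact DFunLike.congr_fun this f

/-- Twisted derivations that are given on the matrix of generators by right multiplication with a
scalar matrix are left covariant. -/
theorem comul_twistedDerivation (X : SU2 q →ₗ[ℂ] SU2 q)
    (hX : ∀ f g, X (f * g) = f * X g + X f * twist q g)
    (ha : comul q (X (a q)) = LinearMap.lTensor (SU2 q) X (comul q (a q)))
    (hb : comul q (X (b q)) = LinearMap.lTensor (SU2 q) X (comul q (b q)))
    (hc : comul q (X (c q)) = LinearMap.lTensor (SU2 q) X (comul q (c q)))
    (hd : comul q (X (d q)) = LinearMap.lTensor (SU2 q) X (comul q (d q))) (f : SU2 q) :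
    comul q (X f) = LinearMap.lTensor (SU2 q) X (comul q f) := by
  have key : ∀ u v : SU2 q ⊗[ℂ] SU2 q,
      LinearMap.lTensor (SU2 q) X (u * v) =
        u * LinearMap.lTensor (SU2 q) X v +
        LinearMap.lTensor (SU2 q) X u *
          Algebra.TensorProduct.map (AlgHom.id ℂ _) (twist q) v := by
    intro u v
    induction u using TensorProduct.induction_on with
    | zero => simp
    | add x y hx hy => rw [add_mul, map_add, hx, hy, add_mul, map_add, add_mul]; abel
    | tmul x s =>
      induction v using TensorProduct.induction_on with
      | zero => simp
      | add x y hx hy => rw [mul_add, map_add, hx, hy, map_add, map_add, mul_add, mul_add]; abel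
      | tmul y t =>
        simp only [Algebra.TensorProduct.tmul_mul_tmul, LinearMap.lTensor_tmul,
          Algebra.TensorProduct.map_tmul, AlgHom.id_apply, hX, TensorProduct.tmul_add]
  refine induct q (P := fun f => comul q (X f) = LinearMap.lTensor (SU2 q) X (comul q f))
    ?_ ha hb hc hd ?_ ?_ f
  · intro z
    have h1 : X 1 = 0 := by
      have := hX 1 1
      rw [map_one (twist q), mul_one, one_mul, mul_one] at this
      simpa using this
    rw [Algebra.algebraMap_eq_smul_one, map_smul, map_smul, map_smul, map_smul, map_one (comul q),
      Algebra.TensorProduct.one_def, LinearMap.lTensor_tmul, h1, map_zero, TensorProduct.tmul_zero]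
  · intro f g hf hg
    rw [map_add, map_add, map_add, map_add, hf, hg]
  · intro f g hf hg
    rw [hX, map_add, map_mul, map_mul, map_mul, key, hf, hg, comul_twist]

theorem comul_XPlus (f : SU2 q) :
    comul q (XPlus q f) = LinearMap.lTensor (SU2 q) (XPlus q) (comul q f) := by
  refine comul_twistedDerivation (XPlus q) (XPlus_mul q) ?_ ?_ ?_ ?_ f <;>
  simp [XPlus_a, XPlus_b, XPlus_c, XPlus_d, comul_a, comul_b, comul_c, comul_d]

theorem comul_XMinus (f : SU2 q) :
    comul q (XMinus q f) = LinearMap.lTensor (SU2 q) (XMinus q) (comul q f) := by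
  refine comul_twistedDerivation (XMinus q) (XMinus_mul q) ?_ ?_ ?_ ?_ f <;>
  simp [XMinus_a, XMinus_b, XMinus_c, XMinus_d, comul_a, comul_b, comul_c, comul_d]

/-- Coassociativity with `π` applied to the third leg; both sides are algebra maps, so generators
suffice. -/
theorem lTensor_coact_comul (f : SU2 q) :
    Algebra.TensorProduct.map (AlgHom.id ℂ _) (coact q) (comul q f) =
      Algebra.TensorProduct.assoc ℂ ℂ ℂ _ _ _
        (Algebra.TensorProduct.map (comul q) (AlgHom.id ℂ _) (coact q f)) := by
  have : (Algebra.TensorProduct.map (AlgHom.id ℂ _) (coact q)).comp (comul q) =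
      ((Algebra.TensorProduct.assoc ℂ ℂ ℂ _ _ _).toAlgHom.comp
        (Algebra.TensorProduct.map (comul q) (AlgHom.id ℂ _))).comp (coact q) := by
    apply hom_ext <;>
    simp [comul_a, comul_b, comul_c, comul_d, coact_a, coact_b, coact_c, coact_d,
      TensorProduct.add_tmul]
  exact DFunLike.congr_fun this f

theorem lTensor_homProj_comul (l : ℤ) {k : ℤ} {f : SU2 q} (hf : f ∈ E q k) :
    LinearMap.lTensor (SU2 q) (homProj q l) (comul q f) = if k = l then comul q f else 0 := by
  set ev : LaurentPolynomial ℂ →ₗ[ℂ] ℂ :=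
    Finsupp.lapply l ∘ₗ (AddMonoidAlgebra.coeffLinearEquiv ℂ).toLinearMap with hev
  have hT : ev (LaurentPolynomial.T k) = if k = l then 1 else 0 := LaurentPolynomial.T_apply l k
  have h1 : ∀ t : SU2 q ⊗[ℂ] SU2 q, LinearMap.lTensor (SU2 q) (homProj q l) t =
      LinearMap.lTensor (SU2 q) ((TensorProduct.rid ℂ (SU2 q)).toLinearMap ∘ₗ
        LinearMap.lTensor (SU2 q) ev)
        (Algebra.TensorProduct.map (AlgHom.id ℂ _) (coact q) t) := by
    intro t
    induction t using TensorProduct.induction_on with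
    | zero => simp
    | add x y hx hy => rw [map_add, map_add, map_add, hx, hy]
    | tmul x y => rfl
  have h2 : ∀ t : SU2 q ⊗[ℂ] SU2 q,
      LinearMap.lTensor (SU2 q) ((TensorProduct.rid ℂ (SU2 q)).toLinearMap ∘ₗ
        LinearMap.lTensor (SU2 q) ev)
        (Algebra.TensorProduct.assoc ℂ ℂ ℂ _ _ _ (t ⊗ₜ[ℂ] LaurentPolynomial.T k)) =
      ev (LaurentPolynomial.T k) • t := by
    intro t
    induction t using TensorProduct.induction_on with
    | zero => simp
    | add x y hx hy => rw [TensorProduct.add_tmul, map_add, map_add, hx, hy, smul_add]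
    | tmul x y => simp
  rw [h1, lTensor_coact_comul, (mem_E q).1 hf, Algebra.TensorProduct.map_tmul, AlgHom.id_apply, h2,
    hT, ite_smul, one_smul, zero_smul]

/-! ### Normal ordered monomials -/

theorem mul_pow_of_smul_comm {B : Type*} [Ring B] [Algebra ℂ B] {x y : B} {r : ℂ}
    (h : x * y = r • (y * x)) (n : ℕ) : x * y ^ n = r ^ n • (y ^ n * x) := by
  induction n with
  | zero => simp
  | succ n ih =>
    rw [pow_succ y, ← mul_assoc, ih, smul_mul_assoc, mul_assoc, h, mul_smul_comm, smul_smul,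
      pow_succ, mul_assoc]

theorem pow_mul_of_smul_comm {B : Type*} [Ring B] [Algebra ℂ B] {x y : B} {r : ℂ}
    (h : x * y = r • (y * x)) (n : ℕ) : x ^ n * y = r ^ n • (y * x ^ n) := by
  induction n with
  | zero => simp
  | succ n ih =>
    rw [pow_succ' x, mul_assoc, ih, mul_smul_comm, ← mul_assoc, h, smul_mul_assoc, smul_smul,
      mul_assoc, ← pow_succ]

variable (q) in
/-- The span of the normal ordered monomials `a ^ i b ^ j c ^ k` and `d ^ i b ^ j c ^ k`. -/
def monomialSpan : Submodule ℂ (SU2 q) :=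
  Submodule.span ℂ ({f | ∃ i j k : ℕ, f = a q ^ i * b q ^ j * c q ^ k} ∪
    {f | ∃ i j k : ℕ, f = d q ^ i * b q ^ j * c q ^ k})

theorem a_monomial_mem (i j k : ℕ) : a q ^ i * b q ^ j * c q ^ k ∈ monomialSpan q :=
  Submodule.subset_span (Or.inl ⟨i, j, k, rfl⟩)
theorem d_monomial_mem (i j k : ℕ) : d q ^ i * b q ^ j * c q ^ k ∈ monomialSpan q :=
  Submodule.subset_span (Or.inr ⟨i, j, k, rfl⟩)

theorem mul_mem_monomialSpan {x : SU2 q}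
    (ha : ∀ i j k : ℕ, x * (a q ^ i * b q ^ j * c q ^ k) ∈ monomialSpan q)
    (hd : ∀ i j k : ℕ, x * (d q ^ i * b q ^ j * c q ^ k) ∈ monomialSpan q)
    {f : SU2 q} (hf : f ∈ monomialSpan q) : x * f ∈ monomialSpan q := by
  have : monomialSpan q ≤ (monomialSpan q).comap (LinearMap.mulLeft ℂ x) := by
    refine Submodule.span_le.2 ?_
    rintro _ (⟨i, j, k, rfl⟩ | ⟨i, j, k, rfl⟩)
    exacts [ha i j k, hd i j k]
  exact this hf

theorem b_mul_mem {f : SU2 q} (hf : f ∈ monomialSpan q) : b q * f ∈ monomialSpan q := by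
  refine mul_mem_monomialSpan (fun i j k => ?_) (fun i j k => ?_) hf
  · rw [← mul_assoc, ← mul_assoc, mul_pow_of_smul_comm (r_ba q), smul_mul_assoc, smul_mul_assoc,
      mul_assoc (a q ^ i), ← pow_succ']
    exact Submodule.smul_mem _ _ (a_monomial_mem _ _ _)
  · rw [← mul_assoc, ← mul_assoc, mul_pow_of_smul_comm (sl2Rel q).bd, smul_mul_assoc,
      smul_mul_assoc, mul_assoc (d q ^ i), ← pow_succ']
    exact Submodule.smul_mem _ _ (d_monomial_mem _ _ _)

theorem commute_c_b : Commute (c q) (b q) := r_cb q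

theorem c_mul_mem {f : SU2 q} (hf : f ∈ monomialSpan q) : c q * f ∈ monomialSpan q := by
  refine mul_mem_monomialSpan (fun i j k => ?_) (fun i j k => ?_) hf
  · rw [← mul_assoc, ← mul_assoc, mul_pow_of_smul_comm (r_ca q), smul_mul_assoc, smul_mul_assoc,
      mul_assoc (a q ^ i), (commute_c_b.pow_right j).eq, ← mul_assoc, mul_assoc _ (c q), ← pow_succ']
    exact Submodule.smul_mem _ _ (a_monomial_mem _ _ _)
  · rw [← mul_assoc, ← mul_assoc, mul_pow_of_smul_comm (sl2Rel q).cd, smul_mul_assoc,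
      smul_mul_assoc, mul_assoc (d q ^ i), (commute_c_b.pow_right j).eq, ← mul_assoc,
      mul_assoc _ (c q), ← pow_succ']
    exact Submodule.smul_mem _ _ (d_monomial_mem _ _ _)

theorem a_mul_mem {f : SU2 q} (hf : f ∈ monomialSpan q) : a q * f ∈ monomialSpan q := by
  have ha : ∀ i j k : ℕ, a q * (a q ^ i * b q ^ j * c q ^ k) ∈ monomialSpan q := fun i j k => by
    rw [← mul_assoc, ← mul_assoc, ← pow_succ']
    exact a_monomial_mem _ _ _
  refine mul_mem_monomialSpan ha (fun i j k => ?_) hf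
  rcases i with _ | i
  · simpa using ha 0 j k
  · rw [pow_succ', mul_assoc (d q), mul_assoc (d q), ← mul_assoc (a q), r_ad, add_mul, one_mul,
      smul_mul_assoc, mul_assoc (b q)]
    exact add_mem (d_monomial_mem _ _ _)
      (Submodule.smul_mem _ _ (b_mul_mem (c_mul_mem (d_monomial_mem _ _ _))))

theorem d_mul_mem {f : SU2 q} (hf : f ∈ monomialSpan q) : d q * f ∈ monomialSpan q := by
  have hd : ∀ i j k : ℕ, d q * (d q ^ i * b q ^ j * c q ^ k) ∈ monomialSpan q := fun i j k => by
    rw [← mul_assoc, ← mul_assoc, ← pow_succ']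
    exact d_monomial_mem _ _ _
  refine mul_mem_monomialSpan (fun i j k => ?_) hd hf
  rcases i with _ | i
  · simpa using hd 0 j k
  · rw [pow_succ', mul_assoc (a q), mul_assoc (a q), ← mul_assoc (d q), r_da, add_mul, one_mul,
      smul_mul_assoc, mul_assoc (b q)]
    exact add_mem (a_monomial_mem _ _ _)
      (Submodule.smul_mem _ _ (b_mul_mem (c_mul_mem (a_monomial_mem _ _ _))))

theorem monomialSpan_eq_top : monomialSpan q = ⊤ := by
  rw [eq_top_iff]
  rintro f -
  have h : ∀ m ∈ monomialSpan q, f * m ∈ monomialSpan q := by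
    refine induct q (P := fun f => ∀ m ∈ monomialSpan q, f * m ∈ monomialSpan q) ?_
      (fun _ => a_mul_mem) (fun _ => b_mul_mem) (fun _ => c_mul_mem) (fun _ => d_mul_mem) ?_ ?_ f
    · intro z m hm
      rw [← Algebra.smul_def]
      exact Submodule.smul_mem _ _ hm
    · intro f g hf hg m hm
      rw [add_mul]
      exact add_mem (hf m hm) (hg m hm)
    · intro f g hf hg m hm
      rw [mul_assoc]
      exact hf _ (hg m hm)
  have h1 : (1 : SU2 q) ∈ monomialSpan q := by simpa using a_monomial_mem (q := q) 0 0 0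
  simpa using h 1 h1

theorem pow_mem_E {k : ℤ} {f : SU2 q} (hf : f ∈ E q k) (n : ℕ) : f ^ n ∈ E q (n * k) := by
  induction n with
  | zero => simpa using one_mem_E q
  | succ n ih => rw [pow_succ]; exact mul_mem_E q (by push_cast; ring) ih hf

theorem b_pow_mul_c_pow_mem_E (j k : ℕ) : b q ^ j * c q ^ k ∈ E q (j - k) :=
  mul_mem_E q (by ring) (pow_mem_E b_mem_E j) (pow_mem_E c_mem_E k)

theorem a_monomial_mem_E (i j k : ℕ) : a q ^ i * b q ^ j * c q ^ k ∈ E q (-i + j - k) := by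
  rw [mul_assoc]
  exact mul_mem_E q (by ring) (pow_mem_E a_mem_E i) (b_pow_mul_c_pow_mem_E j k)

theorem d_monomial_mem_E (i j k : ℕ) : d q ^ i * b q ^ j * c q ^ k ∈ E q (i + j - k) := by
  rw [mul_assoc]
  exact mul_mem_E q (by ring) (pow_mem_E d_mem_E i) (b_pow_mul_c_pow_mem_E j k)

/-! ### The range of `X₊` -/

variable (q) in
/-- The `q`-number `1 + q⁻² + ⋯ + q^(-2 (n - 1))`. -/
def qNum (n : ℕ) : ℝ := ∑ j ∈ Finset.range n, (((q : ℝ) ^ 2)⁻¹) ^ j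

theorem qNum_succ_pos (n : ℕ) : 0 < qNum q (n + 1) := by
  have hq := q.ne_zero
  exact Finset.sum_pos (fun j _ => by positivity) (by simp)

theorem qNum_succ_ne_zero (n : ℕ) : (qNum q (n + 1) : ℂ) ≠ 0 := by
  exact_mod_cast (qNum_succ_pos n).ne'

theorem qNum_succ (n : ℕ) : qNum q (n + 1) = ((q : ℝ) ^ 2)⁻¹ * qNum q n + 1 := geom_sum_succ

/-- Each further factor `x` contributes `q⁻²` to the earlier terms: `q⁻¹` from the degree of `x` in
the Leibniz rule and `q⁻¹` from moving `y` past it. -/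
theorem XPlus_pow_succ {x y : SU2 q} (hx : x ∈ E q (-1)) (hy : XPlus q x = y)
    (hxy : y * x = (q : ℂ)⁻¹ • (x * y)) (n : ℕ) :
    XPlus q (x ^ (n + 1)) = (qNum q (n + 1) : ℂ) • (x ^ n * y) := by
  induction n with
  | zero => simp [qNum, hy]
  | succ n ih =>
    rw [pow_succ x (n + 1), XPlus_mul_of_mem _ hx, ih, hy, qNum_succ (n + 1),
      smul_mul_assoc, mul_assoc, hxy, mul_smul_comm, ← mul_assoc, ← pow_succ, smul_smul, smul_smul,
      zpow_neg_one]
    nth_rewrite 1 [← one_smul ℂ (x ^ (n + 1) * y)]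
    rw [← add_smul]
    push_cast
    congr 1
    ring

theorem XPlus_pow_mul (x y : SU2 q) (hx : XPlus q x = 0) (n : ℕ) :
    XPlus q (x ^ n * y) = x ^ n * XPlus q y := by
  have : XPlus q (x ^ n) = 0 := by
    induction n with
    | zero => simpa using XPlus_one
    | succ n ih => rw [pow_succ, XPlus_mul, ih, hx, mul_zero, zero_mul, add_zero]
  rw [XPlus_mul, this, zero_mul, add_zero]

theorem b_pow_c_pow_d (j k : ℕ) :
    b q ^ j * c q ^ k * d q = (q : ℂ) ^ (j + k) • (d q * (b q ^ j * c q ^ k)) := by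
  rw [mul_assoc, pow_mul_of_smul_comm (sl2Rel q).cd, mul_smul_comm, ← mul_assoc,
    pow_mul_of_smul_comm (sl2Rel q).bd, smul_mul_assoc, smul_smul, mul_assoc, add_comm, pow_add]

theorem XPlus_d_monomial (i j k : ℕ) : XPlus q (d q ^ i * b q ^ j * c q ^ (k + 1)) =
    (qNum q (k + 1) * (q : ℂ) ^ (j + k) : ℂ) • (d q ^ (i + 1) * b q ^ j * c q ^ k) := by
  rw [mul_assoc, XPlus_pow_mul _ _ (XPlus_d q), XPlus_pow_mul _ _ (XPlus_b q),
    XPlus_pow_succ c_mem_E (XPlus_c q) (r_dc q), mul_smul_comm, ← mul_assoc (b q ^ j),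
    b_pow_c_pow_d, smul_smul, mul_smul_comm, ← mul_assoc, ← pow_succ, mul_assoc]

/-- Differentiating the power of `c` produces a `d`, and `ad = 1 + q bc` splits that term in two.
The second piece combines with the derivative of the power of `a`. -/
theorem XPlus_a_monomial (i j k : ℕ) : XPlus q (a q ^ (i + 1) * b q ^ j * c q ^ (k + 1)) =
    (qNum q (k + 1) * (q : ℂ) ^ (j + k) : ℂ) • (a q ^ i * b q ^ j * c q ^ k) +
    (qNum q (k + 1) * (q : ℂ) ^ (j + k + 1) + qNum q (i + 1) * (q : ℂ) ^ ((j : ℤ) - (k + 1)) : ℂ) •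
      (a q ^ i * b q ^ (j + 1) * c q ^ (k + 1)) := by
  have h1 := b_pow_mul_c_pow_mem_E (q := q) j (k + 1)
  push_cast at h1
  have h2 : a q ^ i * a q * (d q * (b q ^ j * c q ^ k)) =
      a q ^ i * b q ^ j * c q ^ k + (q : ℂ) • (a q ^ i * b q ^ (j + 1) * c q ^ (k + 1)) := by
    rw [mul_assoc, ← mul_assoc (a q), r_ad, add_mul, one_mul, mul_add, smul_mul_assoc,
      mul_smul_comm, mul_assoc (b q), ← mul_assoc (c q), (commute_c_b.pow_right j).eq,
      mul_assoc (b q ^ j), ← pow_succ', ← mul_assoc (b q), ← pow_succ', ← mul_assoc, ← mul_assoc]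
  rw [mul_assoc, XPlus_mul_of_mem _ h1, XPlus_pow_mul _ _ (XPlus_b q),
    XPlus_pow_succ c_mem_E (XPlus_c q) (r_dc q), XPlus_pow_succ a_mem_E (XPlus_a q) (r_ba q),
    mul_smul_comm, ← mul_assoc (b q ^ j), b_pow_c_pow_d, smul_smul, mul_smul_comm, pow_succ (a q),
    h2, smul_mul_assoc, smul_smul, mul_assoc _ (b q), ← mul_assoc (b q), ← pow_succ',
    ← mul_assoc (a q ^ i), smul_add, smul_smul, add_assoc, ← add_smul]
  congr 2
  ring

theorem XPlus_a_pow_b_pow (i j : ℕ) : XPlus q (a q ^ (i + 1) * b q ^ j) =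
    (qNum q (i + 1) * (q : ℂ) ^ j : ℂ) • (a q ^ i * b q ^ (j + 1)) := by
  have h : XPlus q (b q ^ j) = 0 := by
    simpa [XPlus_one] using XPlus_pow_mul (b q) 1 (XPlus_b q) j
  rw [XPlus_mul_of_mem _ (pow_mem_E b_mem_E j), XPlus_pow_succ a_mem_E (XPlus_a q) (r_ba q), h,
    mul_zero, zero_add, smul_mul_assoc, smul_smul, mul_assoc, ← pow_succ', mul_one, zpow_natCast,
    mul_comm]

/-- `1`, the range of `X₊` and the parts of nonzero degree span `ℂ_q[SU₂]`. -/
theorem eq_top_of_range_XPlus_le (W : Submodule ℂ (SU2 q)) (h1 : 1 ∈ W)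
    (hX : ∀ f, XPlus q f ∈ W) (hE : ∀ k ≠ 0, E q k ≤ W) : W = ⊤ := by
  have hq := q_ne_zero q
  have hqr := q.ne_zero
  -- The degree-zero monomials containing `a`, by induction on the exponent of `c`: modulo the range
  -- of `X₊`, the exponents of `b` and `c` can both be lowered by one.
  have ha : ∀ k i : ℕ, a q ^ i * b q ^ (i + k) * c q ^ k ∈ W := by
    intro k
    induction k with
    | zero =>
      rintro (_ | i)
      · simpa using h1
      · have := hX (a q ^ (i + 1 + 1) * b q ^ i)
        rw [XPlus_a_pow_b_pow, Submodule.smul_mem_iff _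
          (mul_ne_zero (qNum_succ_ne_zero _) (pow_ne_zero _ hq))] at this
        simpa using this
    | succ k ih =>
      intro i
      have h2 := hX (a q ^ (i + 1) * b q ^ (i + k) * c q ^ (k + 1))
      rw [XPlus_a_monomial, Submodule.add_mem_iff_right _ (Submodule.smul_mem _ _ (ih i)),
        Submodule.smul_mem_iff] at h2
      · exact h2
      -- After `q ^ (i - 1)` is factored out only even powers of `q` remain, so the coefficient is
      -- nonzero for negative `q` too.
      · have hpos : 0 < qNum q (k + 1) * (q : ℝ) ^ (2 * (k + 1)) + qNum q (i + 1) := by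
          have := qNum_succ_pos (q := q) k
          have := qNum_succ_pos (q := q) i
          rw [pow_mul]
          positivity
        have h3 : (qNum q (k + 1) * (q : ℂ) ^ (i + k + k + 1) +
            qNum q (i + 1) * (q : ℂ) ^ (((i + k : ℕ) : ℤ) - (k + 1)) : ℂ) =
            (q : ℂ) ^ ((i : ℤ) - 1) *
              ((qNum q (k + 1) * (q : ℝ) ^ (2 * (k + 1)) + qNum q (i + 1) : ℝ) : ℂ) := by
          have e1 : ((i + k : ℕ) : ℤ) - (k + 1) = (i : ℤ) - 1 := by push_cast; ring
          have e2 : (q : ℂ) ^ (i + k + k + 1) =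
              (q : ℂ) ^ ((i : ℤ) - 1) * (q : ℂ) ^ (2 * (k + 1)) := by
            rw [← zpow_natCast, ← zpow_natCast, ← zpow_add₀ hq]
            congr 1
            push_cast; ring
          rw [e1, e2]
          push_cast
          ring
        rw [h3]
        exact mul_ne_zero (zpow_ne_zero _ hq) (by exact_mod_cast hpos.ne')
  have hd : ∀ i k : ℕ, d q ^ (i + 1) * b q ^ k * c q ^ (i + 1 + k) ∈ W := by
    intro i k
    have := hX (d q ^ i * b q ^ k * c q ^ (i + 1 + k + 1))
    rwa [XPlus_d_monomial, Submodule.smul_mem_iff _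
      (mul_ne_zero (qNum_succ_ne_zero _) (pow_ne_zero _ hq))] at this
  rw [eq_top_iff, ← monomialSpan_eq_top, monomialSpan, Submodule.span_le]
  rintro _ (⟨i, j, k, rfl⟩ | ⟨i, j, k, rfl⟩)
  · by_cases h : (-i + j - k : ℤ) = 0
    · obtain rfl : j = i + k := by omega
      exact ha k i
    · exact hE _ h (a_monomial_mem_E i j k)
  · by_cases h : (i + j - k : ℤ) = 0
    · obtain rfl : k = i + j := by omega
      rcases i with _ | i
      · simpa using ha j 0
      · exact hd i j
    · exact hE _ h (d_monomial_mem_E i j k)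

end
end PodlesSphere

namespace PodlesSphere
noncomputable section
variable {q : ℝˣ}

/-! ### The Haar functional -/

/-- A left invariant and a right invariant normalised functional coincide. -/
theorem eq_of_left_right_invariant {h₁ h₂ : SU2 q →ₗ[ℂ] ℂ} (h₁_one : h₁ 1 = 1) (h₂_one : h₂ 1 = 1)
    (left : ∀ f, TensorProduct.rid ℂ (SU2 q) (LinearMap.lTensor (SU2 q) h₁ (comul q f)) = h₁ f • 1)
    (right : ∀ f, TensorProduct.lid ℂ (SU2 q) (LinearMap.rTensor (SU2 q) h₂ (comul q f)) =
      h₂ f • 1) : h₁ = h₂ := by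
  -- Both sides are `(h₂ ⊗ h₁)(t)`. At `t = Δ(f)` one side reduces to `h₁ f` and the other to `h₂
  -- f`.
  have key : ∀ t : SU2 q ⊗[ℂ] SU2 q,
      h₂ (TensorProduct.rid ℂ (SU2 q) (LinearMap.lTensor (SU2 q) h₁ t)) =
      h₁ (TensorProduct.lid ℂ (SU2 q) (LinearMap.rTensor (SU2 q) h₂ t)) := by
    intro t
    induction t using TensorProduct.induction_on with
    | zero => simp
    | add x y hx hy => simp only [map_add, hx, hy]
    | tmul x y => simp [mul_comm]
  ext f
  have := key (comul q f)
  rw [left, right, map_smul, map_smul, h₁_one, h₂_one] at this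
  simpa using this

theorem swapRel : SL2Rel (q : ℂ) (a q) (c q) (b q) (d q) where
  ab := (sl2Rel q).ac
  ac := (sl2Rel q).ab
  bc := (sl2Rel q).bc.symm
  bd := (sl2Rel q).cd
  cd := (sl2Rel q).bd
  ad_da := by rw [r_cb]; exact (sl2Rel q).ad_da
  det := by rw [r_cb]; exact (sl2Rel q).det

variable (q) in
/-- The automorphism that exchanges `b` and `c`. -/
def swap : SU2 q →ₐ[ℂ] SU2 q := lift swapRel

theorem swap_swap (f : SU2 q) : swap q (swap q f) = f := by
  have : (swap q).comp (swap q) = AlgHom.id ℂ _ := by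
    apply hom_ext <;> simp [swap, lift_a, lift_b, lift_c, lift_d]
  exact DFunLike.congr_fun this f

theorem comul_swap (f : SU2 q) : comul q (swap q f) = Algebra.TensorProduct.comm ℂ _ _
    (Algebra.TensorProduct.map (swap q) (swap q) (comul q f)) := by
  have : (comul q).comp (swap q) = ((Algebra.TensorProduct.comm ℂ _ _).toAlgHom.comp
      (Algebra.TensorProduct.map (swap q) (swap q))).comp (comul q) := by
    apply hom_ext <;>
    simp [swap, lift_a, lift_b, lift_c, lift_d, comul_a, comul_b, comul_c, comul_d]
  exact DFunLike.congr_fun this f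

/-- Exchanging `b` and `c` transposes the matrix of generators, hence reverses the coproduct and
interchanges the two kinds of invariance. -/
theorem right_invariant_comp_swap {h : SU2 q →ₗ[ℂ] ℂ}
    (left : ∀ f, TensorProduct.rid ℂ (SU2 q) (LinearMap.lTensor (SU2 q) h (comul q f)) = h f • 1)
    (f : SU2 q) : TensorProduct.lid ℂ (SU2 q)
      (LinearMap.rTensor (SU2 q) (h ∘ₗ (swap q).toLinearMap) (comul q f)) =
      (h ∘ₗ (swap q).toLinearMap) f • 1 := by
  have key : ∀ t : SU2 q ⊗[ℂ] SU2 q, TensorProduct.lid ℂ (SU2 q)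
      (LinearMap.rTensor (SU2 q) (h ∘ₗ (swap q).toLinearMap) t) =
      swap q (TensorProduct.rid ℂ (SU2 q) (LinearMap.lTensor (SU2 q) h
        (Algebra.TensorProduct.comm ℂ _ _
          (Algebra.TensorProduct.map (swap q) (swap q) t)))) := by
    intro t
    induction t using TensorProduct.induction_on with
    | zero => simp
    | add x y hx hy => simp only [map_add, hx, hy]
    | tmul x y => simp [swap_swap]
  rw [key, ← comul_swap, left, map_smul, map_one]
  rfl

theorem exists_isHaar : ∃ h : SU2 q →ₗ[ℂ] ℂ, IsHaar q h := by
  obtain ⟨φ, hφ, hφX⟩ := Submodule.exists_le_ker_of_notMem (one_notMem_range_XPlus (q := q))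
  replace hφX : ∀ f, φ (XPlus q f) = 0 := fun f => hφX ⟨f, rfl⟩
  -- Composing with the projection to degree zero makes `ψ` vanish in nonzero degrees; it still
  -- kills the range of `X₊`, which shifts the degree by two.
  set ψ : SU2 q →ₗ[ℂ] ℂ := (φ 1)⁻¹ • φ ∘ₗ homProj q 0 with hψ
  have hψ1 : ψ 1 = 1 := by
    simp [hψ, homProj_self (one_mem_E q), hφ]
  have hψX : ψ ∘ₗ XPlus q = 0 := by
    ext f
    simp [hψ, homProj_XPlus (show (-2 : ℤ) + 2 = 0 by norm_num), hφX]
  have left : ∀ f, TensorProduct.rid ℂ (SU2 q) (LinearMap.lTensor (SU2 q) ψ (comul q f)) =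
      ψ f • 1 := by
    -- The elements at which left invariance holds form a subspace, to which the spanning criterion
    -- applies.
    have htop := eq_top_of_range_XPlus_le (LinearMap.ker
      ((TensorProduct.rid ℂ (SU2 q)).toLinearMap ∘ₗ LinearMap.lTensor (SU2 q) ψ ∘ₗ
        (comul q).toLinearMap - LinearMap.toSpanSingleton ℂ (SU2 q) 1 ∘ₗ ψ)) ?_ ?_ ?_
    · intro f
      have hf : f ∈ (⊤ : Submodule ℂ (SU2 q)) := trivial
      rw [← htop] at hf
      exact sub_eq_zero.1 hf
    · simp [Algebra.TensorProduct.one_def, hψ1]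
    · intro f
      have : ψ (XPlus q f) = 0 := LinearMap.congr_fun hψX f
      simp only [LinearMap.mem_ker, LinearMap.sub_apply, LinearMap.comp_apply,
        AlgHom.toLinearMap_apply, comul_XPlus, this, map_zero, sub_zero,
        ← LinearMap.lTensor_comp_apply, hψX, LinearMap.lTensor_zero, LinearMap.zero_apply]
    · intro k hk f hf
      have h1 : ψ f = 0 := by simp [hψ, homProj_of_mem hf, hk]
      have h2 : LinearMap.lTensor (SU2 q) ψ (comul q f) = 0 := by
        rw [hψ, LinearMap.lTensor_smul, LinearMap.smul_apply, LinearMap.lTensor_comp_apply,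
          lTensor_homProj_comul 0 hf, if_neg hk, map_zero, smul_zero]
      simp only [LinearMap.mem_ker, LinearMap.sub_apply, LinearMap.comp_apply,
        AlgHom.toLinearMap_apply, h1, h2, map_zero, sub_zero]
  have right := right_invariant_comp_swap left
  have heq := eq_of_left_right_invariant hψ1 (by simp [hψ1]) left right
  rw [← heq] at right
  exact ⟨ψ, hψ1, left, right⟩

theorem IsHaar.unique {h₁ h₂ : SU2 q →ₗ[ℂ] ℂ} (H₁ : IsHaar q h₁) (H₂ : IsHaar q h₂) : h₁ = h₂ :=
  eq_of_left_right_invariant H₁.map_one H₂.map_one H₁.left_invariant H₂.right_invariant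

namespace IsHaar
variable {h : SU2 q →ₗ[ℂ] ℂ}

/-- Apply `h ⊗ id` to `Δ(Xf) = (id ⊗ X)Δ(f)`: right invariance turns it into `h(Xf) 1 = h(f) X(1) =
0`. -/
theorem apply_eq_zero_of_lTensor (H : IsHaar q h) {X : SU2 q →ₗ[ℂ] SU2 q} (hX1 : X 1 = 0)
    (hX : ∀ f, comul q (X f) = LinearMap.lTensor (SU2 q) X (comul q f)) (f : SU2 q) :
    h (X f) = 0 := by
  have key : ∀ t : SU2 q ⊗[ℂ] SU2 q, TensorProduct.lid ℂ (SU2 q)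
      (LinearMap.rTensor (SU2 q) h (LinearMap.lTensor (SU2 q) X t)) =
      X (TensorProduct.lid ℂ (SU2 q) (LinearMap.rTensor (SU2 q) h t)) := by
    intro t
    induction t using TensorProduct.induction_on with
    | zero => simp
    | add x y hx hy => simp only [map_add, hx, hy]
    | tmul x y => simp
  have h1 := H.right_invariant (X f)
  rw [hX, key, H.right_invariant, map_smul, hX1, smul_zero] at h1
  exact (smul_eq_zero.1 h1.symm).resolve_right one_ne_zero_SU2

theorem apply_XPlus (H : IsHaar q h) (f : SU2 q) : h (XPlus q f) = 0 :=
  H.apply_eq_zero_of_lTensor XPlus_one comul_XPlus f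

theorem apply_XMinus (H : IsHaar q h) (f : SU2 q) : h (XMinus q f) = 0 :=
  H.apply_eq_zero_of_lTensor XMinus_one comul_XMinus f

theorem apply_eq_zero_of_mem (H : IsHaar q h) {k : ℤ} (hk : k ≠ 0) {f : SU2 q} (hf : f ∈ E q k) : h f = 0 := by
  have key : ∀ t : SU2 q ⊗[ℂ] SU2 q, TensorProduct.lid ℂ (SU2 q)
      (LinearMap.rTensor (SU2 q) h (LinearMap.lTensor (SU2 q) (homProj q 0) t)) =
      homProj q 0 (TensorProduct.lid ℂ (SU2 q) (LinearMap.rTensor (SU2 q) h t)) := by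
    intro t
    induction t using TensorProduct.induction_on with
    | zero => simp
    | add x y hx hy => simp only [map_add, hx, hy]
    | tmul x y => simp
  have h1 := key (comul q f)
  rw [lTensor_homProj_comul 0 hf, if_neg hk, map_zero, map_zero, H.right_invariant, map_smul,
    homProj_self (one_mem_E q)] at h1
  exact (smul_eq_zero.1 h1.symm).resolve_right one_ne_zero_SU2

end IsHaar

/-! ### Nondegeneracy of the Haar functional -/

/-- Surjectivity of the Galois map `x ⊗ y ↦ (x ⊗ 1)Δ(y)`, morally `1 ⊗ f = (S(f₁) ⊗ 1)Δ(f₂)`. The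
coefficients used on generators are the entries of the antipode matrix. -/
theorem one_tmul_mem_span (f : SU2 q) : (1 : SU2 q) ⊗ₜ[ℂ] f ∈
    Submodule.span ℂ {t | ∃ x y : SU2 q, t = (x ⊗ₜ[ℂ] 1) * comul q y} := by
  have hq := q_ne_zero q
  set M := Submodule.span ℂ {t | ∃ x y : SU2 q, t = (x ⊗ₜ[ℂ] 1) * comul q y} with hM
  have hmem : ∀ x y : SU2 q, (x ⊗ₜ[ℂ] 1) * comul q y ∈ M :=
    fun x y => Submodule.subset_span ⟨x, y, rfl⟩
  refine induct q (P := fun f => (1 : SU2 q) ⊗ₜ[ℂ] f ∈ M) ?_ ?_ ?_ ?_ ?_ ?_ ?_ f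
  · intro z
    have := M.smul_mem z (hmem 1 1)
    rwa [map_one, mul_one, ← TensorProduct.tmul_smul, ← Algebra.algebraMap_eq_smul_one] at this
  · convert M.sub_mem (hmem (d q) (a q)) (M.smul_mem (q : ℂ)⁻¹ (hmem (b q) (c q))) using 1
    simp only [comul_a, comul_c, mul_add, Algebra.TensorProduct.tmul_mul_tmul, one_mul, r_da, r_db,
      TensorProduct.add_tmul, ← TensorProduct.smul_tmul', smul_add]
    abel
  · convert M.sub_mem (hmem (d q) (b q)) (M.smul_mem (q : ℂ)⁻¹ (hmem (b q) (d q))) using 1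
    simp only [comul_b, comul_d, mul_add, Algebra.TensorProduct.tmul_mul_tmul, one_mul, r_da, r_db,
      TensorProduct.add_tmul, ← TensorProduct.smul_tmul', smul_add]
    abel
  · convert M.sub_mem (hmem (a q) (c q)) (M.smul_mem (q : ℂ) (hmem (c q) (a q))) using 1
    simp only [comul_a, comul_c, mul_add, Algebra.TensorProduct.tmul_mul_tmul, one_mul, r_ad, r_ca,
      r_cb, TensorProduct.add_tmul, ← TensorProduct.smul_tmul', smul_add, smul_smul,
      mul_inv_cancel₀ hq, one_smul]
    abel
  · convert M.sub_mem (hmem (a q) (d q)) (M.smul_mem (q : ℂ) (hmem (c q) (b q))) using 1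
    simp only [comul_b, comul_d, mul_add, Algebra.TensorProduct.tmul_mul_tmul, one_mul, r_ad, r_ca,
      r_cb, TensorProduct.add_tmul, ← TensorProduct.smul_tmul', smul_add, smul_smul,
      mul_inv_cancel₀ hq, one_smul]
    abel
  · intro f g hf hg
    rw [TensorProduct.tmul_add]
    exact add_mem hf hg
  · intro f g hf hg
    have h1 : ∀ x y : SU2 q, ∀ t ∈ M, (x ⊗ₜ[ℂ] 1) * (t * comul q y) ∈ M := by
      intro x y t ht
      refine Submodule.span_induction (p := fun t _ => (x ⊗ₜ[ℂ] 1) * (t * comul q y) ∈ M)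
        ?_ (by simp) ?_ ?_ ht
      · rintro _ ⟨x', y', rfl⟩
        rw [mul_assoc, ← map_mul, ← mul_assoc, Algebra.TensorProduct.tmul_mul_tmul, one_mul]
        exact hmem _ _
      · intro t s _ _ ht hs
        rw [add_mul, mul_add]
        exact add_mem ht hs
      · intro z t _ ht
        rw [smul_mul_assoc, mul_smul_comm]
        exact M.smul_mem z ht
    -- Products work because `1 ⊗ f` commutes with `x ⊗ 1`, so it can be moved next to `Δ(y)`.
    have h2 : ∀ t ∈ M, ((1 : SU2 q) ⊗ₜ[ℂ] f) * t ∈ M := by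
      intro t ht
      refine Submodule.span_induction (p := fun t _ => ((1 : SU2 q) ⊗ₜ[ℂ] f) * t ∈ M)
        ?_ (by simp) ?_ ?_ ht
      · rintro _ ⟨x, y, rfl⟩
        have := h1 x y _ hf
        have hcomm : (x ⊗ₜ[ℂ] (1 : SU2 q)) * (1 ⊗ₜ[ℂ] f) = (1 ⊗ₜ[ℂ] f) * (x ⊗ₜ[ℂ] 1) := by
          simp only [Algebra.TensorProduct.tmul_mul_tmul, mul_one, one_mul]
        rwa [← mul_assoc, hcomm, mul_assoc] at this
      · intro t s _ _ ht hs
        rw [mul_add]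
        exact add_mem ht hs
      · intro z t _ ht
        rw [mul_smul_comm]
        exact M.smul_mem z ht
    have := h2 _ hg
    rwa [Algebra.TensorProduct.tmul_mul_tmul, one_mul] at this

open MulOpposite in
theorem antipodeRel : SL2Rel (B := (SU2 q)ᵐᵒᵖ) (q : ℂ) (op (d q)) (op (-((q : ℂ)⁻¹ • b q)))
    (op (-((q : ℂ) • c q))) (op (a q)) := by
  have hq := q_ne_zero q
  constructor <;> simp only [← op_mul, ← op_smul, ← op_sub, ← op_one,
    mul_neg, neg_mul, mul_smul_comm, smul_mul_assoc, r_ba, r_ca, r_cb, r_db, r_dc, r_ad, r_da] <;>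
  congr 1 <;> simp only [smul_smul, smul_neg] <;> match_scalars <;> field_simp <;> ring

variable (q) in
/-- The antipode of `ℂ_q[SU₂]`, as an algebra map to the opposite algebra. -/
def antipode : SU2 q →ₐ[ℂ] (SU2 q)ᵐᵒᵖ := lift antipodeRel

variable (q) in
/-- The linear map `x ⊗ y ↦ S(x) y`. -/
def antipodeMul : SU2 q ⊗[ℂ] SU2 q →ₗ[ℂ] SU2 q :=
  TensorProduct.lift (LinearMap.mul ℂ (SU2 q) ∘ₗ
    (MulOpposite.opLinearEquiv ℂ).symm.toLinearMap ∘ₗ (antipode q).toLinearMap)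

theorem antipodeMul_tmul (x y : SU2 q) :
    antipodeMul q (x ⊗ₜ y) = (antipode q x).unop * y := rfl

theorem antipodeMul_comul (f : SU2 q) : antipodeMul q (comul q f) = counit q f • 1 := by
  have hq := q_ne_zero q
  refine induct q (P := fun f => antipodeMul q (comul q f) = counit q f • 1) ?_ ?_ ?_ ?_ ?_ ?_ ?_ f
  · intro z
    rw [AlgHom.commutes, AlgHom.commutes, Algebra.algebraMap_eq_smul_one, map_smul,
      Algebra.TensorProduct.one_def, antipodeMul_tmul, map_one]
    simp
  · simp [comul_a, antipodeMul_tmul, antipode, counit, lift_a, lift_b, r_da,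
      -Complex.coe_smul]
  · simp [comul_b, antipodeMul_tmul, antipode, counit, lift_a, lift_b, r_db,
      -Complex.coe_smul]
  · simp [comul_c, antipodeMul_tmul, antipode, counit, lift_c, lift_d, r_ca, hq,
      smul_smul, -Complex.coe_smul]
  · simp [comul_d, antipodeMul_tmul, antipode, counit, lift_c, lift_d, r_ad, r_cb,
      -Complex.coe_smul]
  · intro f g hf hg
    rw [map_add, map_add, hf, hg, map_add, add_smul]
  · intro f g hf hg
    -- Since `S` reverses products, `S(x)` and `y` end up outside the contraction of `t`, which is a
    -- scalar and can be pulled out.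
    have key : ∀ t u : SU2 q ⊗[ℂ] SU2 q, ∀ z : ℂ, antipodeMul q t = z • 1 →
        antipodeMul q (t * u) = z • antipodeMul q u := by
      intro t u z ht
      induction u using TensorProduct.induction_on with
      | zero => simp
      | add x y hx hy => rw [mul_add, map_add, hx, hy, map_add, smul_add]
      | tmul x y =>
        have : ∀ t : SU2 q ⊗[ℂ] SU2 q, antipodeMul q (t * x ⊗ₜ y) =
            (antipode q x).unop * antipodeMul q t * y := by
          intro t
          induction t using TensorProduct.induction_on with
          | zero => simp
          | add r s hr hs => simp only [add_mul, map_add, hr, hs, mul_add]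
          | tmul r s =>
            simp only [Algebra.TensorProduct.tmul_mul_tmul, antipodeMul_tmul, map_mul,
              MulOpposite.unop_mul, mul_assoc]
        rw [this, ht, antipodeMul_tmul, mul_smul_comm, mul_one, smul_mul_assoc]
    rw [map_mul, key _ _ _ hf, hg, smul_smul, map_mul]

theorem rid_lTensor_counit_comul (f : SU2 q) :
    TensorProduct.rid ℂ (SU2 q) (LinearMap.lTensor (SU2 q) (counit q).toLinearMap (comul q f)) =
      f := by
  have : ((Algebra.TensorProduct.rid ℂ ℂ (SU2 q)).toAlgHom.comp
      (Algebra.TensorProduct.map (AlgHom.id ℂ _) (counit q))).comp (comul q) = AlgHom.id ℂ _ := by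
    apply hom_ext <;>
    simp [comul_a, comul_b, comul_c, comul_d, counit, lift_a, lift_b, lift_c, lift_d]
  exact DFunLike.congr_fun this f

/-- Expand the first leg in a basis: the coordinate functionals recover the coefficients in the
second leg, which therefore lie in `R`. -/
theorem mem_range_lTensor_of_forall_functional (R : Submodule ℂ (SU2 q)) (t : SU2 q ⊗[ℂ] SU2 q)
    (ht : ∀ φ : SU2 q →ₗ[ℂ] ℂ, TensorProduct.lid ℂ (SU2 q) (LinearMap.rTensor (SU2 q) φ t) ∈ R) :
    t ∈ LinearMap.range (LinearMap.lTensor (SU2 q) R.subtype) := by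
  classical
  let B := Module.Basis.ofVectorSpace ℂ (SU2 q)
  obtain ⟨r, rfl⟩ := TensorProduct.eq_repr_basis_left B t
  rw [Finsupp.sum]
  refine Submodule.sum_mem _ fun i _ => ?_
  have h1 := ht (B.coord i)
  have h2 : TensorProduct.lid ℂ (SU2 q) (LinearMap.rTensor (SU2 q) (B.coord i)
      (r.sum fun i n => B i ⊗ₜ[ℂ] n)) = r i := by
    simp +contextual [Finsupp.sum, Finsupp.single_apply, eq_comm]
  rw [h2] at h1
  exact ⟨B i ⊗ₜ ⟨r i, h1⟩, by simp⟩

/-- The pairing `(f, g) ↦ h (f g)` is nondegenerate. -/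
theorem IsHaar.eq_zero_of_forall_mul {h : SU2 q →ₗ[ℂ] ℂ} (H : IsHaar q h) {g : SU2 q}
    (hg : ∀ f, h (f * g) = 0) : g = 0 := by
  let R : Submodule ℂ (SU2 q) :=
    { carrier := {g | ∀ f, h (f * g) = 0}
      zero_mem' := by simp
      add_mem' := by
        intro x y hx hy f
        rw [mul_add, map_add, hx f, hy f, add_zero]
      smul_mem' := by
        intro z x hx f
        rw [mul_smul_comm, map_smul, hx f, smul_zero] }
  have hR : ∀ x, x ∈ R ↔ ∀ f, h (f * x) = 0 := fun _ => Iff.rfl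
  -- By left invariance `(id ⊗ h)((y ⊗ 1)Δ(z)Δ(x)) = h(zx) y = 0`. Elements `1 ⊗ f` are sums of such
  -- `(y ⊗ 1)Δ(z)`, so every slice of `Δ(x)` is in the radical.
  have hcomul : ∀ x ∈ R, comul q x ∈ LinearMap.range (LinearMap.lTensor (SU2 q) R.subtype) := by
    intro x hx
    have h1 : ∀ t ∈ Submodule.span ℂ {t | ∃ x y : SU2 q, t = (x ⊗ₜ[ℂ] 1) * comul q y},
        TensorProduct.rid ℂ (SU2 q) (LinearMap.lTensor (SU2 q) h (t * comul q x)) = 0 := by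
      intro t ht
      refine Submodule.span_induction (p := fun t _ =>
        TensorProduct.rid ℂ (SU2 q) (LinearMap.lTensor (SU2 q) h (t * comul q x)) = 0)
        ?_ (by simp) ?_ ?_ ht
      · rintro _ ⟨y, z, rfl⟩
        have h2 : ∀ t : SU2 q ⊗[ℂ] SU2 q,
            TensorProduct.rid ℂ (SU2 q) (LinearMap.lTensor (SU2 q) h ((y ⊗ₜ 1) * t)) =
            y * TensorProduct.rid ℂ (SU2 q) (LinearMap.lTensor (SU2 q) h t) := by
          intro t
          induction t using TensorProduct.induction_on with
          | zero => simp
          | add r s hr hs => simp only [map_add, mul_add, hr, hs]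
          | tmul r s => simp
        rw [mul_assoc, ← map_mul, h2, H.left_invariant, hx, zero_smul, mul_zero]
      · intro t s _ _ ht hs
        rw [add_mul, map_add, map_add, ht, hs, add_zero]
      · intro z t _ ht
        rw [smul_mul_assoc, map_smul, map_smul, ht, smul_zero]
    refine mem_range_lTensor_of_forall_functional R _ fun φ => ?_
    rw [hR]
    intro f
    have h3 : ∀ t : SU2 q ⊗[ℂ] SU2 q,
        h (f * TensorProduct.lid ℂ (SU2 q) (LinearMap.rTensor (SU2 q) φ t)) =
        φ (TensorProduct.rid ℂ (SU2 q) (LinearMap.lTensor (SU2 q) h ((1 ⊗ₜ f) * t))) := by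
      intro t
      induction t using TensorProduct.induction_on with
      | zero => simp
      | add r s hr hs => simp only [map_add, mul_add, hr, hs]
      | tmul r s => simp [mul_comm]
    rw [h3, h1 _ (one_tmul_mem_span f), map_zero]
  -- As `R` is a left ideal, `S(x₁)x₂ = ε(x)1` lies in it; pairing with `1` and using `h 1 = 1`
  -- gives `ε(x) = 0`.
  have hcounit : ∀ x ∈ R, counit q x = 0 := by
    intro x hx
    obtain ⟨t, ht⟩ := hcomul x hx
    have h1 : ∀ t, antipodeMul q (LinearMap.lTensor (SU2 q) R.subtype t) ∈ R := by
      intro t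
      induction t using TensorProduct.induction_on with
      | zero => simp
      | add r s hr hs => rw [map_add, map_add]; exact add_mem hr hs
      | tmul r s =>
        rw [LinearMap.lTensor_tmul, antipodeMul_tmul, hR]
        intro f
        rw [← mul_assoc]
        exact s.2 _
    have h2 := h1 t
    rw [ht, antipodeMul_comul, hR] at h2
    simpa [H.map_one] using h2 1
  obtain ⟨t, ht⟩ := hcomul g hg
  have hzero : (counit q).toLinearMap ∘ₗ R.subtype = 0 := by
    ext x
    exact hcounit x x.2
  rw [← rid_lTensor_counit_comul g, ← ht, ← LinearMap.lTensor_comp_apply, hzero,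
    LinearMap.lTensor_zero, LinearMap.zero_apply, map_zero]

end
end PodlesSphere

namespace PodlesSphere
noncomputable section
variable {q : ℝˣ}

/-! ### The `*`-structure -/

theorem star_add_SU2 (f g : SU2 q) : star (f + g) = star f + star g := by
  change ofConj q (starHom q (f + g)) = _
  rw [map_add]; rfl
theorem star_zero_SU2 : star (0 : SU2 q) = 0 := by
  simpa using star_smul_conj q 0 (0 : SU2 q)
theorem star_neg_SU2 (f : SU2 q) : star (-f) = -star f := by
  simpa using star_smul_conj q (-1) f
theorem star_one_SU2 : star (1 : SU2 q) = 1 := by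
  change ofConj q (starHom q 1) = _
  rw [map_one]; rfl
theorem star_a : star (a q) = d q := by
  change ofConj q (starHom q (a q)) = _
  rw [starHom, lift_a]; rfl
theorem star_b : star (b q) = -((q : ℂ) • c q) := by
  change ofConj q (starHom q (b q)) = _
  rw [starHom, lift_b]; rfl
theorem star_c : star (c q) = -((q : ℂ)⁻¹ • b q) := by
  change ofConj q (starHom q (c q)) = _
  rw [starHom, lift_c]; rfl
theorem star_d : star (d q) = a q := by
  change ofConj q (starHom q (d q)) = _
  rw [starHom, lift_d]; rfl

theorem star_star_SU2 (f : SU2 q) : star (star f) = f := by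
  have hq := q_ne_zero q
  refine induct q (P := fun f => star (star f) = f) ?_ ?_ ?_ ?_ ?_ ?_ ?_ f
  · intro z
    rw [Algebra.algebraMap_eq_smul_one, star_smul_conj, star_smul_conj, star_one_SU2,
      star_one_SU2, Complex.conj_conj]
  · rw [star_a, star_d]
  · rw [star_b, star_neg_SU2, star_smul_conj, star_c, Complex.conj_ofReal, smul_neg, neg_neg,
      smul_smul, mul_inv_cancel₀ hq, one_smul]
  · rw [star_c, star_neg_SU2, star_smul_conj, star_b, map_inv₀, Complex.conj_ofReal, smul_neg,
      neg_neg, smul_smul, inv_mul_cancel₀ hq, one_smul]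
  · rw [star_d, star_a]
  · intro f g hf hg
    rw [star_add_SU2, star_add_SU2, hf, hg]
  · intro f g hf hg
    rw [star_mul_rev, star_mul_rev, hf, hg]

theorem conj_zpow (k : ℤ) : starRingEnd ℂ ((q : ℂ) ^ k) = (q : ℂ) ^ k := by
  rw [map_zpow₀, Complex.conj_ofReal]

/-- The two claims are proved together: on a product the Leibniz rule for `star g * star f` needs
the degree of `star f`. -/
theorem star_mem_and_XPlus_star {k : ℤ} {f : SU2 q} (hf : f ∈ E q k) :
    star f ∈ E q (-k) ∧ XPlus q (star f) = -((q : ℂ) ^ (2 - k) • star (XMinus q f)) := by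
  have hq := q_ne_zero q
  let G : ℤ → Submodule ℂ (SU2 q) := fun k =>
    { carrier := {f | f ∈ E q k ∧ star f ∈ E q (-k) ∧
        XPlus q (star f) = -((q : ℂ) ^ (2 - k) • star (XMinus q f))}
      zero_mem' := by simp [star_zero_SU2]
      add_mem' := by
        rintro f g ⟨hf, hf', hf''⟩ ⟨hg, hg', hg''⟩
        refine ⟨add_mem hf hg, by rw [star_add_SU2]; exact add_mem hf' hg', ?_⟩
        rw [star_add_SU2, map_add, hf'', hg'', map_add, star_add_SU2, smul_add, neg_add]
      smul_mem' := by
        rintro z f ⟨hf, hf', hf''⟩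
        refine ⟨Submodule.smul_mem _ _ hf,
          by rw [star_smul_conj]; exact Submodule.smul_mem _ _ hf', ?_⟩
        rw [star_smul_conj, map_smul, hf'', map_smul, star_smul_conj, smul_neg, smul_comm] }
  refine (E_le_of_generators G (fun k f hf => hf.1) ⟨one_mem_E q, ?_, ?_⟩ ⟨a_mem_E, ?_, ?_⟩
    ⟨b_mem_E, ?_, ?_⟩ ⟨c_mem_E, ?_, ?_⟩ ⟨d_mem_E, ?_, ?_⟩ ?_ k hf).2
  · rw [star_one_SU2]; exact one_mem_E q
  · rw [star_one_SU2, XPlus_one, XMinus_one, star_zero_SU2, smul_zero, neg_zero]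
  · rw [star_a, neg_neg]; exact d_mem_E
  · rw [star_a, XPlus_d, XMinus_a, star_zero_SU2, smul_zero, neg_zero]
  · rw [star_b]; exact neg_mem (Submodule.smul_mem _ _ c_mem_E)
  · rw [star_b, XMinus_b, star_a, map_neg, map_smul, XPlus_c]; norm_num
  · rw [star_c, neg_neg]; exact neg_mem (Submodule.smul_mem _ _ b_mem_E)
  · rw [star_c, XMinus_c, star_zero_SU2, map_neg, map_smul, XPlus_b, smul_zero, smul_zero]
  · rw [star_d]; exact a_mem_E
  · rw [star_d, XMinus_d, star_c, XPlus_a, smul_neg, neg_neg, smul_smul]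
    norm_num [hq]
  · rintro k l f g ⟨hf, hf', hf''⟩ ⟨hg, hg', hg''⟩
    refine ⟨mul_mem_E q rfl hf hg, ?_, ?_⟩
    · rw [star_mul_rev]
      exact mul_mem_E q (by ring) hg' hf'
    · rw [star_mul_rev, XPlus_mul_of_mem _ hf', hf'', hg'', XMinus_mul_of_mem _ hg, star_add_SU2,
        star_smul_conj, conj_zpow, star_mul_rev, star_mul_rev, smul_add, smul_smul, mul_neg,
        neg_mul, smul_neg, mul_smul_comm, smul_mul_assoc, smul_smul, ← zpow_add₀ hq,
        ← zpow_add₀ hq, neg_add, add_comm]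
      congr 4 <;> ring_nf

theorem star_mem_E {k l : ℤ} (h : -k = l) {f : SU2 q} (hf : f ∈ E q k) : star f ∈ E q l :=
  h ▸ (star_mem_and_XPlus_star hf).1

theorem XPlus_star {k : ℤ} {f : SU2 q} (hf : f ∈ E q k) :
    XPlus q (star f) = -((q : ℂ) ^ (2 - k) • star (XMinus q f)) :=
  (star_mem_and_XPlus_star hf).2

theorem XMinus_star {k : ℤ} {f : SU2 q} (hf : f ∈ E q k) :
    XMinus q (star f) = -((q : ℂ) ^ (-2 - k) • star (XPlus q f)) := by
  have hq := q_ne_zero q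
  have h := XPlus_star (star_mem_E rfl hf)
  rw [star_star_SU2] at h
  rw [h, star_neg_SU2, star_smul_conj, conj_zpow, star_star_SU2, smul_neg, neg_neg, smul_smul,
    ← zpow_add₀ hq]
  ring_nf
  rw [zpow_zero, one_smul]

namespace IsHaar
variable {h : SU2 q →ₗ[ℂ] ℂ}

/-- Testing in degree `k` suffices: for `f` of another degree `f * star g` has nonzero degree, where
`h` vanishes. -/
theorem eq_zero_of_forall_mul_star (H : IsHaar q h) {k : ℤ} {g : SU2 q} (hg : g ∈ E q k)
    (hzero : ∀ f ∈ E q k, h (f * star g) = 0) : g = 0 := by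
  rw [← star_star_SU2 g, H.eq_zero_of_forall_mul (g := star g), star_zero_SU2]
  refine induct_E (P := fun f => h (f * star g) = 0) (fun l f hf => ?_) fun x y hx hy => ?_
  · by_cases hl : l = k
    · subst hl
      exact hzero f hf
    · exact H.apply_eq_zero_of_mem (sub_ne_zero.2 hl)
        (mul_mem_E q (sub_eq_add_neg l k).symm hf (star_mem_E rfl hg))
  · rw [add_mul, map_add, hx, hy, add_zero]

/-- Integration by parts for `X₊`. -/
theorem apply_XPlus_mul_star (H : IsHaar q h) {k : ℤ} (f : SU2 q) {g : SU2 q} (hg : g ∈ E q k) :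
    h (XPlus q f * star g) = (q : ℂ) ^ 2 * h (f * star (XMinus q g)) := by
  have hq := q_ne_zero q
  have h1 := H.apply_XPlus (f * star g)
  rw [XPlus_mul_of_mem _ (star_mem_E rfl hg), XPlus_star hg, mul_neg, mul_smul_comm, map_add,
    map_neg, map_smul, map_smul, smul_eq_mul, smul_eq_mul, zpow_sub₀ hq, zpow_neg,
    zpow_ofNat] at h1
  have : (q : ℂ) ^ k ≠ 0 := zpow_ne_zero _ hq
  -- The Leibniz factor `q ^ (-k)` and the factor `q ^ (2 - k)` from `XPlus_star` differ by `q²`, so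
  -- the degree drops out.
  field_simp at h1
  linear_combination h1

/-- Integration by parts for `X₋`. -/
theorem apply_XMinus_mul_star (H : IsHaar q h) {k : ℤ} (f : SU2 q) {g : SU2 q} (hg : g ∈ E q k) :
    (q : ℂ) ^ 2 * h (XMinus q f * star g) = h (f * star (XPlus q g)) := by
  have hq := q_ne_zero q
  have h1 := H.apply_XMinus (f * star g)
  rw [XMinus_mul_of_mem _ (star_mem_E rfl hg), XMinus_star hg, mul_neg, mul_smul_comm, map_add,
    map_neg, map_smul, map_smul, smul_eq_mul, smul_eq_mul, zpow_sub₀ hq, zpow_neg, zpow_neg,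
    zpow_ofNat] at h1
  have : (q : ℂ) ^ k ≠ 0 := zpow_ne_zero _ hq
  field_simp at h1
  linear_combination h1

/-- The inner product of forms is nondegenerate. -/
theorem eq_of_forall_innerProd (H : IsHaar q h) {ν ν' : Forms q}
    (hν : ∀ ω, innerProd q h ω ν = innerProd q h ω ν') : ν = ν' := by
  have hq := q_ne_zero q
  have key : ∀ {k : ℤ} (x y : E q k), (∀ f ∈ E q k, h (f * star (x : SU2 q)) =
      h (f * star (y : SU2 q))) → x = y := by
    intro k x y hxy
    refine Subtype.ext (sub_eq_zero.1 (H.eq_zero_of_forall_mul_star (sub_mem x.2 y.2) ?_))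
    intro f hf
    rw [sub_eq_add_neg, star_add_SU2, star_neg_SU2, mul_add, mul_neg, map_add, map_neg, hxy f hf,
      add_neg_cancel]
  refine Prod.ext (key _ _ fun f hf => ?_) (Prod.ext (key _ _ fun f hf => ?_)
    (Prod.ext (key _ _ fun f hf => ?_) (key _ _ fun f hf => ?_)))
  · simpa [innerProd, metric] using hν (⟨f, hf⟩, 0, 0, 0)
  · simpa [innerProd, metric] using hν (0, ⟨f, hf⟩, 0, 0)
  · simpa [innerProd, metric, hq] using hν (0, 0, ⟨f, hf⟩, 0)
  · simpa [innerProd, metric] using hν (0, 0, 0, ⟨f, hf⟩)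

theorem isAdjoint_unique (H : IsHaar q h) {T S S' : Module.End ℂ (Forms q)}
    (hS : IsAdjoint q h T S) (hS' : IsAdjoint q h T S') : S = S' :=
  LinearMap.ext fun ν => H.eq_of_forall_innerProd fun ω => (hS ω ν).symm.trans (hS' ω ν)

end IsHaar

/-! ### The adjoints -/

variable (q) in
/-- The dual Lefschetz operator, `Λ (k e⁺ ∧ e⁻) = -k`. -/
def dualLefschetz : Module.End ℂ (Forms q) where
  toFun ω := (-ω.2.2.2, 0, 0, 0)
  map_add' ω ν := by simp [add_comm]
  map_smul' z ω := by simp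

variable (q) in
/-- `∂* (F e⁺) = i D₋(F)` and `∂* (k e⁺ ∧ e⁻) = i D₋(k) e⁻`. -/
def delAdjoint : Module.End ℂ (Forms q) where
  toFun ω := (Complex.I • DMinus q 2 0 (by norm_num) ω.2.1, 0,
    Complex.I • DMinus q 0 (-2) (by norm_num) ω.2.2.2, 0)
  map_add' ω ν := by simp
  map_smul' z ω := by simp [smul_comm z]

variable (q) in
/-- `∂̄* (G e⁻) = i q² D₊(G)` and `∂̄* (k e⁺ ∧ e⁻) = -i D₊(k) e⁺`. -/
def delbarAdjoint : Module.End ℂ (Forms q) where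
  toFun ω := ((Complex.I * (q : ℂ) ^ 2) • DPlus q (-2) 0 (by norm_num) ω.2.2.1,
    -(Complex.I • DPlus q 0 2 (by norm_num) ω.2.2.2), 0, 0)
  map_add' ω ν := by
    simp only [Prod.fst_add, Prod.snd_add, map_add, smul_add, neg_add, Prod.mk_add_mk, add_zero]
  map_smul' z ω := by
    simp only [Prod.smul_fst, Prod.smul_snd, map_smul, Prod.smul_mk, smul_zero, RingHom.id_apply,
      smul_neg, smul_comm z (Complex.I * (q : ℂ) ^ 2), smul_comm z Complex.I]

theorem lefschetz_apply (ω : Forms q) : lefschetz q ω = (0, 0, 0, -ω.1) := by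
  refine Prod.ext ?_ (Prod.ext ?_ (Prod.ext ?_ ?_)) <;> apply Subtype.ext <;>
  simp [lefschetz, wedge, kappa]

theorem coe_DPlus {k l : ℤ} (h : k + 2 = l) (f : E q k) :
    (DPlus q k l h f : SU2 q) = (q : ℂ)⁻¹ • XPlus q f := rfl
theorem coe_DMinus {k l : ℤ} (h : k - 2 = l) (f : E q k) :
    (DMinus q k l h f : SU2 q) = (-Complex.I * (q : ℂ)) • XMinus q f := rfl

section
variable {h : SU2 q →ₗ[ℂ] ℂ}

theorem isAdjoint_lefschetz : IsAdjoint q h (lefschetz q) (dualLefschetz q) := by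
  intro ω ν
  simp [innerProd, metric, lefschetz_apply, dualLefschetz, star_zero_SU2, star_neg_SU2]

theorem isAdjoint_del (H : IsHaar q h) : IsAdjoint q h (del q) (delAdjoint q) := by
  intro ω ν
  have hq := q_ne_zero q
  have h1 := H.apply_XPlus_mul_star ω.1 ν.2.1.2
  -- Here the `q²` in `∂(G e⁻)` is matched by the weight `q²` of `e⁻` in the metric, so `∂*` has the
  -- same form on both summands.
  have h2 := H.apply_XPlus_mul_star ω.2.2.1 ν.2.2.2.2
  simp only [innerProd, metric, del, delAdjoint, LinearMap.coe_mk, AddHom.coe_mk, coe_DPlus,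
    coe_DMinus, Submodule.coe_smul, ZeroMemClass.coe_zero, star_zero_SU2, zero_mul, mul_zero,
    smul_zero, add_zero, zero_add, star_smul_conj, smul_mul_assoc, mul_smul_comm, map_add,
    map_smul, h1, h2, smul_eq_mul, map_mul, map_neg, Complex.conj_I, Complex.conj_ofReal]
  field_simp
  ring_nf
  simp only [Complex.I_sq]
  ring

theorem isAdjoint_delbar (H : IsHaar q h) : IsAdjoint q h (delbar q) (delbarAdjoint q) := by
  intro ω ν
  have hq := q_ne_zero q
  have h1 := H.apply_XMinus_mul_star ω.1 ν.2.2.1.2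
  have h2 := H.apply_XMinus_mul_star ω.2.1 ν.2.2.2.2
  simp only [innerProd, metric, delbar, delbarAdjoint, LinearMap.coe_mk, AddHom.coe_mk, coe_DPlus,
    coe_DMinus, Submodule.coe_smul, Submodule.coe_neg, ZeroMemClass.coe_zero, star_zero_SU2,
    zero_mul, mul_zero, smul_zero, add_zero, zero_add, star_smul_conj, star_neg_SU2, neg_mul,
    mul_neg, smul_mul_assoc, mul_smul_comm, map_add, map_neg, map_smul, ← h1, ← h2, smul_eq_mul,
    map_mul, map_pow, map_inv₀, Complex.conj_I, Complex.conj_ofReal]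
  field_simp

end

end
end PodlesSphere

/-! ### The Kähler identities. -/

theorem mainTheorem4 (q : ℝˣ) :
    (∃! h : PodlesSphere.SU2 q →ₗ[ℂ] ℂ, PodlesSphere.IsHaar q h) ∧
    ∀ h : PodlesSphere.SU2 q →ₗ[ℂ] ℂ, PodlesSphere.IsHaar q h →
      (∃! Λ, PodlesSphere.IsAdjoint q h (PodlesSphere.lefschetz q) Λ) ∧
      (∃! S, PodlesSphere.IsAdjoint q h (PodlesSphere.del q) S) ∧
      (∃! S, PodlesSphere.IsAdjoint q h (PodlesSphere.delbar q) S) ∧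
      ∀ Λ delStar delbarStar : Module.End ℂ (PodlesSphere.Forms q),
        PodlesSphere.IsAdjoint q h (PodlesSphere.lefschetz q) Λ →
        PodlesSphere.IsAdjoint q h (PodlesSphere.del q) delStar →
        PodlesSphere.IsAdjoint q h (PodlesSphere.delbar q) delbarStar →
          ⁅PodlesSphere.lefschetz q, delStar⁆ = Complex.I • PodlesSphere.delbar q ∧
          ⁅PodlesSphere.lefschetz q, delbarStar⁆ = -(Complex.I • PodlesSphere.del q) ∧
          ⁅Λ, PodlesSphere.del q⁆ = Complex.I • delbarStar ∧
          ⁅Λ, PodlesSphere.delbar q⁆ = -(Complex.I • delStar) ∧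
          ⁅PodlesSphere.lefschetz q, PodlesSphere.del q⁆ = 0 ∧
          ⁅PodlesSphere.lefschetz q, PodlesSphere.delbar q⁆ = 0 ∧
          ⁅Λ, delStar⁆ = 0 ∧
          ⁅Λ, delbarStar⁆ = 0 := by
  open PodlesSphere in
  refine ⟨?_, fun h H => ⟨?_, ?_, ?_, ?_⟩⟩
  · obtain ⟨h, H⟩ := exists_isHaar (q := q)
    exact ⟨h, H, fun h' H' => H'.unique H⟩
  · exact ⟨_, isAdjoint_lefschetz, fun S hS => H.isAdjoint_unique hS isAdjoint_lefschetz⟩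
  · exact ⟨_, isAdjoint_del H, fun S hS => H.isAdjoint_unique hS (isAdjoint_del H)⟩
  · exact ⟨_, isAdjoint_delbar H, fun S hS => H.isAdjoint_unique hS (isAdjoint_delbar H)⟩
  · intro Λ delStar delbarStar hΛ hdel hdelbar
    -- Uniqueness replaces arbitrary adjoints by the explicit operators; the identities then hold
    -- summand by summand through `i · i = -1` and linearity of `D₊`, `D₋`.
    obtain rfl := H.isAdjoint_unique hΛ isAdjoint_lefschetz
    obtain rfl := H.isAdjoint_unique hdel (isAdjoint_del H)
    obtain rfl := H.isAdjoint_unique hdelbar (isAdjoint_delbar H)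
    refine ⟨?_, ?_, ?_, ?_, ?_, ?_, ?_, ?_⟩ <;> refine LinearMap.ext fun ω => ?_ <;>
    simp only [Ring.lie_def, LinearMap.sub_apply, Module.End.mul_apply, lefschetz_apply,
      dualLefschetz, delAdjoint, delbarAdjoint, del, delbar, LinearMap.coe_mk, AddHom.coe_mk,
      LinearMap.smul_apply, LinearMap.neg_apply, LinearMap.zero_apply, Prod.smul_mk, Prod.mk_sub_mk,
      Prod.neg_mk, map_zero, map_neg, smul_zero, smul_neg, neg_zero, neg_neg, sub_zero, zero_sub,
      smul_smul, ← mul_assoc, Complex.I_mul_I, neg_mul, one_mul, neg_smul, one_smul,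
      Prod.mk_eq_zero, and_self]
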